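/- **Setting.** Let $B>1$, $\theta>0$ and $\lambda\ge B$ (an upper bound for all noise levels that are used) with $\lambda\theta<1$. Put $$\kappa=\frac{\sqrt B+1}{\sqrt B-1},\qquad r=\frac{(B-1)\,e\,\kappa^2\,\theta}{4(1-\lambda\theta)},$$ and assume $r<1$. On a finite-dimensional Hilbert space let $H,\widetilde H_2,\widetilde H_4,\dots$ be Hermitian, let $\mathcal L(X)=\sum_j\big(V_jXV_j^\dagger-\tfrac12\{V_j^\dagger V_j,X\}\big)$ be a Lindblad dissipator with finitely many jump operators, let $\rho_0$ be a density matrix, and let $A$ be an observable with operator norm $\|A\|_\infty\le\alpha$. The noise level is tied to the Trotter step size $\tau$ by $x=c\tau^2$ for a fixed $c>0$. For $x\in[0,B]$ let $\rho(t,x)$, $0\le t\le T$, be the solution with $\rho(0,x)=\rho_0$ of the modified Lindblad equation $$\partial_t\rho=-i[H,\rho]+x\,\mathcal L(\rho)-i\sum_{\ell\ge1}\tau^{2\ell}[\widetilde H_{2\ell},\rho],\qquad \tau=\sqrt{x/c}.$$ Write its right-hand side as $\sum_{j\ge0}x^j\mathcal L_j(\rho)$ and assume $\|\mathcal L_j\|\le\theta^j$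 for all $j\ge0$, in the norm induced by the trace norm. Let $f(x)=\operatorname{tr}(\rho(T,x)A)$. Let $p_n$ be the polynomial of degree at most $n$ that interpolates $f$ at the $n+1$ Chebyshev nodes of the first kind $x_0,\dots,x_n$ on $[1,B]$, and let $\hat p_n$ be the polynomial of degree at most $n$ that takes at $x_j$ the mean of $N_S$ measurement outcomes of $A$ in the state $\rho(T,x_j)$. All the outcomes are independent eigenvalues of $A$, and those at $x_j$ have mean $f(x_j)$. **Theorem.** There are constants $0<c_1<c_2$ and a function $K:\mathbb R\to(0,\infty)$ that depend only on $B,\theta,\lambda$, and for all $T\ge0$ and $\alpha$ there is a constant $n_0$ that depends only on $B,\theta,\lambda,T,\alpha$, such that for every system as above and all $0<\varepsilon<e^{-e}$, $0<\delta<1$ the following holds. If $$n\ \ge\ c_1\,\frac{\log\varepsilon}{\log r}+n_0,$$ then $|p_n(0)-f(0)|<\varepsilon$. If moreover $n\le c_2\,\frac{\log\varepsilon}{\log r}+D$ for some $D\in\mathbb R$ (so that $n$ is of the order $\log\varepsilon/\log r$), and $$N_S\ \ge\ K(D)\,\alpha^2\,\varepsilon^{-(2+4\log\kappa)}\,\log\frac2\delta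 ,$$ then $|\hat p_n(0)-f(0)|<\varepsilon$ with probability at least $1-\delta$. -/

import Mathlib

open MeasureTheory ProbabilityTheory
open scoped Matrix ComplexOrder

noncomputable section

namespace JointMitigation

/-! ### Matrices, norms, superoperators -/

section Matrices

variable {ι : Type*} [Fintype ι] [DecidableEq ι]

/-- The trace norm (Schatten 1-norm) `tr √(XᴴX)`: the sum of the singular values of `X`. -/
def traceNorm (X : Matrix ι ι ℂ) : ℝ :=
  ∑ i, √((Matrix.isHermitian_conjTranspose_mul_self X).eigenvalues i)

/-- The operator norm (Schatten ∞-norm) of a matrix acting on the Euclidean space `ℂ^ι`. -/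
def opNorm (A : Matrix ι ι ℂ) : ℝ := ‖Matrix.toEuclideanCLM (𝕜 := ℂ) A‖

/-- `b` is a bound for the norm of the superoperator `Φ` induced by the trace norm. -/
def InducedNormLE (Φ : Matrix ι ι ℂ → Matrix ι ι ℂ) (b : ℝ) : Prop :=
  ∀ X, traceNorm (Φ X) ≤ b * traceNorm X

/-- The superoperator `X ↦ -i [H, X]`. -/
def unitaryPart (H X : Matrix ι ι ℂ) : Matrix ι ι ℂ :=
  -Complex.I • (H * X - X * H)

/-- The Lindblad dissipator
`X ↦ ∑ j, (V j X (V j)ᴴ - (1/2) {(V j)ᴴ (V j), X})` with jump operators `V j`. -/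
def dissipator {m : ℕ} (V : Fin m → Matrix ι ι ℂ) (X : Matrix ι ι ℂ) : Matrix ι ι ℂ :=
  ∑ j, (V j * X * (V j)ᴴ - (1 / 2 : ℂ) • ((V j)ᴴ * V j * X + X * ((V j)ᴴ * V j)))

/-- Density matrices. -/
def IsDensity (ρ : Matrix ι ι ℂ) : Prop := ρ.PosSemidef ∧ ρ.trace = 1

end Matrices

/-! ### The modified Lindblad equation -/

/-- The data of the modified Lindblad equation on a finite-dimensional Hilbert space: the
Hamiltonian `H`, the coefficients `Ht ℓ` (`ℓ ≥ 1`) of `τ ^ (2 ℓ)` in the modified Hamiltonian of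
the symmetric splitting with step size `τ` (`Ht 0` is not used), the jump operators `V` of the
circuit noise, and the initial state. -/
structure Model (ι : Type*) [Fintype ι] [DecidableEq ι] where
  H : Matrix ι ι ℂ
  H_herm : H.IsHermitian
  Ht : ℕ → Matrix ι ι ℂ
  Ht_herm : ∀ ℓ, (Ht ℓ).IsHermitian
  numJumps : ℕ
  V : Fin numJumps → Matrix ι ι ℂ
  init : Matrix ι ι ℂ
  init_density : IsDensity init

namespace Model

variable {ι : Type*} [Fintype ι] [DecidableEq ι] (M : Model ι)

/-- The right-hand side of the modified Lindblad equation with step size `τ` and noise level `lam`: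
`-i [H, X] + lam 𝓛(X) - i ∑_{ℓ ≥ 1} τ^{2ℓ} [Ht ℓ, X]`. -/
def rhs (τ lam : ℝ) (X : Matrix ι ι ℂ) : Matrix ι ι ℂ :=
  unitaryPart M.H X + (lam : ℂ) • dissipator M.V X
    + ∑' ℓ : ℕ, ((τ ^ (2 * (ℓ + 1)) : ℝ) : ℂ) • unitaryPart (M.Ht (ℓ + 1)) X

/-- The step size that goes with the noise level `lam` when `lam = c τ²`. -/
def stepSize (c lam : ℝ) : ℝ := √(lam / c)

/-- The coefficient `𝓛_j` of `lam ^ j` in the right-hand side of the modified Lindblad equation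
along the curve `lam = c τ²`. -/
def coeff (c : ℝ) : ℕ → Matrix ι ι ℂ → Matrix ι ι ℂ
  | 0, X => unitaryPart M.H X
  | 1, X => dissipator M.V X + ((c⁻¹ : ℝ) : ℂ) • unitaryPart (M.Ht 1) X
  | j + 2, X => (((c⁻¹) ^ (j + 2) : ℝ) : ℂ) • unitaryPart (M.Ht (j + 2)) X

/-- `ρ t τ lam` solves the modified Lindblad equation on the time interval `[0, T]`, from the
initial state of the model, for all noise levels `lam ∈ [0, B]`, with `τ` given by `lam = c τ²`. -/
def IsSolution (c B T : ℝ) (ρ : ℝ → ℝ → ℝ → Matrix ι ι ℂ) : Prop :=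
  ∀ lam ∈ Set.Icc 0 B,
    ρ 0 (stepSize c lam) lam = M.init ∧
    ∀ t ∈ Set.Icc 0 T,
      HasDerivWithinAt (fun s => ρ s (stepSize c lam) lam)
        (M.rhs (stepSize c lam) lam (ρ t (stepSize c lam) lam)) (Set.Icc 0 T) t

end Model

/-- The state at time `T` and noise level `lam`, with the step size tied to the noise level. -/
def jointState {ι : Type*} (c T : ℝ) (ρ : ℝ → ℝ → ℝ → Matrix ι ι ℂ) (lam : ℝ) : Matrix ι ι ℂ :=
  ρ T (Model.stepSize c lam) lam

/-- The expectation value `tr(ρ A)` of the observable `A` in the state `ρ`. -/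
def expect {ι : Type*} [Fintype ι] (A ρ : Matrix ι ι ℂ) : ℝ := (ρ * A).trace.re

/-! ### Richardson extrapolation at Chebyshev nodes -/

/-- The `n + 1` Chebyshev nodes of the first kind, shifted to `[1, B]`. -/
def chebNode (B : ℝ) (n : ℕ) (k : Fin (n + 1)) : ℝ :=
  (B - 1) / 2 * Real.cos ((2 * (k : ℝ) + 1) * Real.pi / (2 * ((n : ℝ) + 1))) + (B + 1) / 2

/-- The value at `0` of the polynomial of degree at most `n` that takes the values `y j` at the
Chebyshev nodes; it equals `∑ j, γ j * y j` with `γ j` the Lagrange basis polynomials at `0`. -/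
def richardson (B : ℝ) (n : ℕ) (y : Fin (n + 1) → ℝ) : ℝ :=
  (Lagrange.interpolate Finset.univ (chebNode B n) y).eval 0

/-- `κ = (√B + 1) / (√B - 1)`. -/
def kappa (B : ℝ) : ℝ := (√B + 1) / (√B - 1)

/-- `(B - 1) e κ² θ / (4 (1 - lam θ))`. -/
def rate (B θ lam : ℝ) : ℝ :=
  (B - 1) * Real.exp 1 * kappa B ^ 2 * θ / (4 * (1 - lam * θ))

/-! ### Measurements -/

/-- `X j i` is the outcome of the `i`-th of `N` measurements of the observable `A` in the state
`σ j`: all outcomes are independent, each is an eigenvalue of `A`, and its mean is the expectation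
value of `A`. -/
structure IsShotRecord {ι Ω : Type*} [Fintype ι] [DecidableEq ι] [MeasurableSpace Ω]
    (P : Measure Ω) (A : Matrix ι ι ℂ) {n N : ℕ} (σ : Fin (n + 1) → Matrix ι ι ℂ)
    (X : Fin (n + 1) → Fin N → Ω → ℝ) : Prop where
  measurable : ∀ j i, Measurable (X j i)
  indep : iIndepFun (fun p : Fin (n + 1) × Fin N => X p.1 p.2) P
  outcome : ∀ j i, ∀ᵐ ω ∂P, X j i ω ∈ spectrum ℝ A
  mean : ∀ j i, ∫ ω, X j i ω ∂P = expect A (σ j)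

/-- The sample mean. -/
def sampleMean {N : ℕ} (x : Fin N → ℝ) : ℝ := (1 / (N : ℝ)) * ∑ i, x i

end JointMitigation

end

/-!
The expectation value `f(x) = tr(ρ(T, x) A)` is the restriction to real `x` of a holomorphic function.
Indeed, along the curve `x = c τ²` the right-hand side of the modified Lindblad equation is the power
series `G(x) = ∑ xʲ 𝓛_j` (`Model.ofMatrix_rhs`), which converges for `|x| < 1/θ`, in the operators on
the matrices with the trace norm; by uniqueness of solutions `ρ(T, x) = exp (T G(x)) ρ₀`
(`Model.IsSolution.ofMatrix_jointState`). Since the trace norm is dual to the operator norm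
(`norm_trace_mul_le`, `exists_trace_mul_eq_traceNorm`), it is a norm, density matrices have norm at
most `1`, and `|f(z)| ≤ α exp (T / (1 - θ |z|))`, independently of the dimension
(`norm_evolvedValue_le`).

*Bias.* The error of interpolation at `0` is `f⁽ⁿ⁺¹⁾(ξ) / (n + 1)!` times the product of the nodes
(`exists_interpolation_error`). Cauchy's estimate on discs of radius `R = s (1/θ - lam)`, `s < 1`,
bounds the first factor by a constant times `R^(-(n+1))`. The second factor is a value of a
Chebyshev polynomial, at most `2 ((B - 1) κ / 4)^(n+1)` (`prod_chebNode_le`). With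
`s = e^(-1/2) / κ` the bias is at most a constant times `(e^(-1/2) r)^(n+1)`
(`abs_richardson_expect_sub_le`, `bias_rate_eq`). Hence it is below `ε / 2` once
`n ≥ c₁ log ε / log r + n₀`, where `c₁ = ℓ / (ℓ + 1/2)` and `ℓ = log (1/r)`.

*Sampling error.* The weights `γ j` satisfy `∑ γ j ² ≤ (B - 1)² κ^(2(n+1)) / 4`
(`sum_weight_sq_le`), because the derivative of the Chebyshev polynomial of degree `n + 1` is at
least `n + 1` in absolute value at its zeros. The deviation of the estimate from its mean is
sub-Gaussian with variance proxy `α² ∑ γ j ² / N` (`hasSubgaussianMGF_richardson`). With `c₂ = 2 ℓ`,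
the bound `n ≤ c₂ log ε / log r + D` says `n ≤ 2 log (1/ε) + D`, so `∑ γ j ²` is at most a constant
times `ε^(-4 log κ)` (`sum_weight_sq_le_rpow`), and Hoeffding's inequality gives the claim. The
factor `e^(-1/2)` gained in the bias is what makes `c₁ < c₂` for every `r < 1`.
-/

namespace JointMitigation

/-! ### Duality of the trace norm and the operator norm -/

section TraceNorm

variable {ι : Type*} [Fintype ι] [DecidableEq ι]

theorem trace_eq_sum_inner (X : Matrix ι ι ℂ)
    (b : OrthonormalBasis ι ℂ (EuclideanSpace ℂ ι)) :
    X.trace = ∑ i, inner ℂ (b i) (Matrix.toEuclideanCLM (𝕜 := ℂ) X (b i)) := by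
  have h := LinearMap.trace_eq_sum_inner
    (Matrix.toEuclideanCLM (𝕜 := ℂ) X : EuclideanSpace ℂ ι →ₗ[ℂ] EuclideanSpace ℂ ι) b
  rw [← Matrix.trace_toLin_eq X (PiLp.basisFun 2 ℂ ι), ← Matrix.toLpLin_eq_toLin]
  exact h

theorem toEuclideanCLM_conjTranspose (X : Matrix ι ι ℂ) :
    Matrix.toEuclideanCLM (𝕜 := ℂ) Xᴴ
      = ContinuousLinearMap.adjoint (Matrix.toEuclideanCLM (𝕜 := ℂ) X) :=
  map_star (Matrix.toEuclideanCLM (𝕜 := ℂ) (n := ι)) X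

theorem toEuclideanCLM_eigenvectorBasis {X : Matrix ι ι ℂ} (hX : X.IsHermitian) (i : ι) :
    Matrix.toEuclideanCLM (𝕜 := ℂ) X (hX.eigenvectorBasis i)
      = (hX.eigenvalues i : ℂ) • hX.eigenvectorBasis i := by
  apply WithLp.ofLp_injective
  rw [Matrix.ofLp_toEuclideanCLM, hX.mulVec_eigenvectorBasis]
  ext j; simp

/-- The images under `X` of an eigenbasis of `XᴴX` are orthogonal, and their squared lengths are
the eigenvalues. -/
theorem inner_map_eigenvectorBasis (X : Matrix ι ι ℂ) (i j : ι) :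
    inner ℂ
      (Matrix.toEuclideanCLM (𝕜 := ℂ) X
        ((Matrix.isHermitian_conjTranspose_mul_self X).eigenvectorBasis i))
      (Matrix.toEuclideanCLM (𝕜 := ℂ) X
        ((Matrix.isHermitian_conjTranspose_mul_self X).eigenvectorBasis j))
      = if i = j then ((Matrix.isHermitian_conjTranspose_mul_self X).eigenvalues j : ℂ) else 0 := by
  have h := toEuclideanCLM_eigenvectorBasis (Matrix.isHermitian_conjTranspose_mul_self X) j
  rw [map_mul, toEuclideanCLM_conjTranspose, mul_apply_eq_comp] at h
  rw [← ContinuousLinearMap.adjoint_inner_right, h, inner_smul_right,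
    OrthonormalBasis.inner_eq_ite]
  simp

theorem norm_map_eigenvectorBasis (X : Matrix ι ι ℂ) (i : ι) :
    ‖Matrix.toEuclideanCLM (𝕜 := ℂ) X
        ((Matrix.isHermitian_conjTranspose_mul_self X).eigenvectorBasis i)‖
      = √((Matrix.isHermitian_conjTranspose_mul_self X).eigenvalues i) := by
  have h := inner_map_eigenvectorBasis X i i
  rw [inner_self_eq_norm_sq_to_K, if_pos rfl] at h
  have h' : ‖Matrix.toEuclideanCLM (𝕜 := ℂ) X
      ((Matrix.isHermitian_conjTranspose_mul_self X).eigenvectorBasis i)‖ ^ 2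
      = (Matrix.isHermitian_conjTranspose_mul_self X).eigenvalues i := by
    have h2 := congrArg Complex.re h
    rw [Complex.ofReal_re] at h2
    rw [← h2, RCLike.ofReal_eq_complex_ofReal, ← Complex.ofReal_pow, Complex.ofReal_re]
  rw [← h', Real.sqrt_sq (norm_nonneg _)]

/-- Hölder's inequality between the trace norm and the operator norm. -/
theorem norm_trace_mul_le (X A : Matrix ι ι ℂ) :
    ‖(X * A).trace‖ ≤ traceNorm X * opNorm A := by
  rw [Matrix.trace_mul_comm,
    trace_eq_sum_inner _ (Matrix.isHermitian_conjTranspose_mul_self X).eigenvectorBasis,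
    traceNorm, Finset.sum_mul]
  refine (norm_sum_le _ _).trans (Finset.sum_le_sum fun i _ => ?_)
  refine (norm_inner_le_norm _ _).trans ?_
  rw [OrthonormalBasis.norm_eq_one, one_mul, map_mul, mul_apply_eq_comp,
    ← norm_map_eigenvectorBasis, mul_comm]
  exact ContinuousLinearMap.le_opNorm _ _

/-- Hölder's inequality is attained, at the adjoint of the partial isometry in the polar
decomposition of `X`. -/
theorem exists_trace_mul_eq_traceNorm (X : Matrix ι ι ℂ) :
    ∃ U : Matrix ι ι ℂ, opNorm U ≤ 1 ∧ (X * U).trace = traceNorm X := by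
  set hX := Matrix.isHermitian_conjTranspose_mul_self X with hXdef
  set b := hX.eigenvectorBasis with hb
  set μ := hX.eigenvalues with hμ
  set Xc := Matrix.toEuclideanCLM (𝕜 := ℂ) X with hXc
  have hμ0 : ∀ i, 0 ≤ μ i := fun i => Matrix.eigenvalues_conjTranspose_mul_self_nonneg X i
  have hin : ∀ i j, inner ℂ (Xc (b i)) (Xc (b j)) = if i = j then (μ j : ℂ) else 0 :=
    inner_map_eigenvectorBasis X
  -- where the singular value vanishes, `u i = 0` because `0⁻¹ = 0`
  set u : ι → EuclideanSpace ℂ ι := fun i => (((√(μ i))⁻¹ : ℝ) : ℂ) • Xc (b i) with hu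
  have huX : ∀ i j, inner ℂ (u i) (Xc (b j)) = if i = j then (√(μ j) : ℂ) else 0 := by
    intro i j
    simp only [hu, inner_smul_left, hin]
    split_ifs with h
    · subst h
      rw [Complex.conj_ofReal, ← Complex.ofReal_mul]
      congr 1
      rcases (Real.sqrt_nonneg (μ i)).eq_or_lt with h0 | h0
      · rw [← h0]
        simp
      · nth_rewrite 2 [← Real.mul_self_sqrt (hμ0 i)]
        field_simp
    · simp
  have huo : Orthonormal ℂ (fun i : {i // μ i ≠ 0} => u i) := by
    rw [orthonormal_iff_ite]
    rintro ⟨i, hi⟩ ⟨j, hj⟩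
    have hj' : √(μ j) ≠ 0 := (Real.sqrt_pos.2 (lt_of_le_of_ne (hμ0 j) (Ne.symm hj))).ne'
    change inner ℂ (u i) ((((√(μ j))⁻¹ : ℝ) : ℂ) • Xc (b j)) = _
    rw [inner_smul_right, huX]
    by_cases h : i = j
    · subst h
      rw [if_pos rfl, if_pos rfl, ← Complex.ofReal_mul, inv_mul_cancel₀ hj', Complex.ofReal_one]
    · rw [if_neg h, if_neg (fun h' => h (congrArg Subtype.val h')), mul_zero]
  set W : EuclideanSpace ℂ ι →L[ℂ] EuclideanSpace ℂ ι :=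
    ∑ i, InnerProductSpace.rankOne ℂ (b i) (u i) with hW
  have hWapp : ∀ w, W w = ∑ i, inner ℂ (u i) w • b i := by
    intro w
    simp [hW]
  have hWin : ∀ w i, inner ℂ (b i) (W w) = inner ℂ (u i) w := by
    intro w i
    rw [hWapp, inner_sum]
    simp [inner_smul_right, OrthonormalBasis.inner_eq_ite]
  refine ⟨(Matrix.toEuclideanCLM (𝕜 := ℂ)).symm W, ?_, ?_⟩
  · rw [opNorm, StarAlgEquiv.apply_symm_apply]
    refine ContinuousLinearMap.opNorm_le_bound _ zero_le_one fun w => ?_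
    rw [one_mul]
    refine le_of_sq_le_sq ?_ (norm_nonneg _)
    rw [← b.sum_sq_norm_inner_right (W w)]
    simp only [hWin]
    have hz : ∑ i, ‖inner ℂ (u i) w‖ ^ 2 = ∑ i : {i // μ i ≠ 0}, ‖inner ℂ (u i) w‖ ^ 2 := by
      have hz' : ∀ i : {i // ¬ μ i ≠ 0}, ‖inner ℂ (u i) w‖ ^ 2 = 0 := by
        rintro ⟨i, hi⟩
        simp [hu, not_not.1 hi]
      rw [← Fintype.sum_subtype_add_sum_subtype (fun i => μ i ≠ 0),
        Finset.sum_eq_zero fun i _ => hz' i, add_zero]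
    rw [hz]
    exact huo.sum_inner_products_le w
  · rw [Matrix.trace_mul_comm, trace_eq_sum_inner _ b, traceNorm, Complex.ofReal_sum]
    refine Finset.sum_congr rfl fun i _ => ?_
    rw [map_mul, StarAlgEquiv.apply_symm_apply, mul_apply_eq_comp, hWin, huX,
      if_pos rfl]

theorem traceNorm_nonneg (X : Matrix ι ι ℂ) : 0 ≤ traceNorm X :=
  Finset.sum_nonneg fun _ _ => Real.sqrt_nonneg _

theorem opNorm_nonneg (A : Matrix ι ι ℂ) : 0 ≤ opNorm A := norm_nonneg _

theorem traceNorm_add_le (X Y : Matrix ι ι ℂ) :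
    traceNorm (X + Y) ≤ traceNorm X + traceNorm Y := by
  obtain ⟨U, hU, h⟩ := exists_trace_mul_eq_traceNorm (X + Y)
  have h1 : ‖((X + Y) * U).trace‖ = traceNorm (X + Y) := by
    rw [h, Complex.norm_real, Real.norm_of_nonneg (traceNorm_nonneg _)]
  rw [← h1, add_mul, Matrix.trace_add]
  refine (norm_add_le _ _).trans (add_le_add ?_ ?_)
  · exact (norm_trace_mul_le X U).trans (mul_le_of_le_one_right (traceNorm_nonneg _) hU)
  · exact (norm_trace_mul_le Y U).trans (mul_le_of_le_one_right (traceNorm_nonneg _) hU)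

theorem traceNorm_smul_le (c : ℂ) (X : Matrix ι ι ℂ) :
    traceNorm (c • X) ≤ ‖c‖ * traceNorm X := by
  obtain ⟨U, hU, h⟩ := exists_trace_mul_eq_traceNorm (c • X)
  have h1 : ‖((c • X) * U).trace‖ = traceNorm (c • X) := by
    rw [h, Complex.norm_real, Real.norm_of_nonneg (traceNorm_nonneg _)]
  rw [← h1, Matrix.smul_mul, Matrix.trace_smul, norm_smul]
  gcongr
  exact (norm_trace_mul_le X U).trans (mul_le_of_le_one_right (traceNorm_nonneg _) hU)

theorem traceNorm_smul (c : ℂ) (X : Matrix ι ι ℂ) :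
    traceNorm (c • X) = ‖c‖ * traceNorm X := by
  refine le_antisymm (traceNorm_smul_le c X) ?_
  rcases eq_or_ne c 0 with rfl | hc
  · simp [traceNorm_nonneg]
  · have h := traceNorm_smul_le c⁻¹ (c • X)
    rw [inv_smul_smul₀ hc, norm_inv] at h
    rwa [← le_inv_mul_iff₀ (norm_pos_iff.2 hc)]

theorem eq_zero_of_traceNorm_eq_zero {X : Matrix ι ι ℂ} (h : traceNorm X = 0) : X = 0 := by
  ext i j
  have h1 := norm_trace_mul_le X (Matrix.single j i 1)
  rw [h, zero_mul, Matrix.trace_mul_single] at h1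
  simpa using h1

theorem traceNorm_zero : traceNorm (0 : Matrix ι ι ℂ) = 0 := by
  simpa using traceNorm_smul 0 (0 : Matrix ι ι ℂ)

theorem IsDensity.traceNorm_le_one {ρ : Matrix ι ι ℂ} (hρ : IsDensity ρ) : traceNorm ρ ≤ 1 := by
  obtain ⟨U, hU, h⟩ := exists_trace_mul_eq_traceNorm ρ
  have h1 : ‖(ρ * U).trace‖ = traceNorm ρ := by
    rw [h, Complex.norm_real, Real.norm_of_nonneg (traceNorm_nonneg _)]
  have hH := hρ.1.isHermitian
  have hsum : ∑ i, hH.eigenvalues i = 1 := by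
    have h2 := hH.trace_eq_sum_eigenvalues
    rw [hρ.2] at h2
    have h3 := congrArg Complex.re h2
    rw [Complex.re_sum] at h3
    exact h3.symm
  rw [← h1, ← hsum, Matrix.trace_mul_comm, trace_eq_sum_inner _ hH.eigenvectorBasis]
  refine (norm_sum_le _ _).trans (Finset.sum_le_sum fun i _ => ?_)
  rw [map_mul, mul_apply_eq_comp, toEuclideanCLM_eigenvectorBasis, map_smul,
    inner_smul_right, norm_mul, Complex.norm_real,
    Real.norm_of_nonneg (hρ.1.eigenvalues_nonneg i)]
  refine mul_le_of_le_one_right (hρ.1.eigenvalues_nonneg i) ?_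
  refine (norm_inner_le_norm _ _).trans ?_
  rw [OrthonormalBasis.norm_eq_one, one_mul]
  refine (ContinuousLinearMap.le_opNorm _ _).trans ?_
  rw [OrthonormalBasis.norm_eq_one, mul_one]
  exact hU

end TraceNorm

/-! ### The Banach space of matrices with the trace norm -/

/-- The space of matrices with the trace norm: a synonym of `Matrix ι ι ℂ`, so that the entrywise
topology that matrices carry by default stays available on the original type. -/
def TraceClass (ι : Type*) : Type _ := Matrix ι ι ℂ

namespace TraceClass

variable {ι : Type*}

instance : AddCommGroup (TraceClass ι) := inferInstanceAs (AddCommGroup (Matrix ι ι ℂ))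

instance : Module ℂ (TraceClass ι) := inferInstanceAs (Module ℂ (Matrix ι ι ℂ))

/-- The identity map from matrices to matrices with the trace norm. -/
def ofMatrix : Matrix ι ι ℂ ≃ₗ[ℂ] TraceClass ι := LinearEquiv.refl ℂ (Matrix ι ι ℂ)

variable [Fintype ι] [DecidableEq ι]

noncomputable instance : Norm (TraceClass ι) := ⟨fun X => traceNorm (ofMatrix.symm X)⟩

theorem norm_def (X : TraceClass ι) : ‖X‖ = traceNorm (ofMatrix.symm X) := rfl

theorem normedSpaceCore : NormedSpace.Core ℂ (TraceClass ι) where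
  norm_nonneg X := traceNorm_nonneg _
  norm_smul c X := by rw [norm_def, map_smul, traceNorm_smul, norm_def]
  norm_triangle X Y := by
    rw [norm_def, map_add]
    exact traceNorm_add_le _ _
  norm_eq_zero_iff X := by
    rw [norm_def]
    constructor
    · intro h
      exact ofMatrix.symm.map_eq_zero_iff.1 (eq_zero_of_traceNorm_eq_zero h)
    · rintro rfl
      rw [map_zero, traceNorm_zero]

noncomputable instance : NormedAddCommGroup (TraceClass ι) := NormedAddCommGroup.ofCore normedSpaceCore

noncomputable instance : NormedSpace ℂ (TraceClass ι) := NormedSpace.ofCore normedSpaceCore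

instance : FiniteDimensional ℂ (TraceClass ι) := Module.Finite.equiv ofMatrix

instance : CompleteSpace (TraceClass ι) := FiniteDimensional.complete ℂ _

end TraceClass

/-! ### The remainder of polynomial interpolation -/

/-- Iterated Rolle theorem: if `g 0` has `m + 1` zeros in an interval, then its `m`-th derivative
`g m` has a zero there. The derivatives are given as a family, so that only their values on the
interval matter. -/
theorem exists_iterated_hasDerivAt_eq_zero {a b : ℝ} (m : ℕ) :
    ∀ (g : ℕ → ℝ → ℝ), (∀ k, ∀ x ∈ Set.Icc a b, HasDerivAt (g k) (g (k + 1) x) x) →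
      ∀ x : Fin (m + 1) → ℝ, StrictMono x → (∀ i, x i ∈ Set.Icc a b) → (∀ i, g 0 (x i) = 0) →
        ∃ ξ ∈ Set.Icc a b, g m ξ = 0 := by
  induction m with
  | zero => exact fun g _ x _ hx h0 => ⟨x 0, hx 0, h0 0⟩
  | succ m ih =>
    intro g hg x hmono hx h0
    have hR : ∀ i : Fin (m + 1), ∃ c ∈ Set.Ioo (x i.castSucc) (x i.succ), g 1 c = 0 := by
      intro i
      have hsub : Set.Icc (x i.castSucc) (x i.succ) ⊆ Set.Icc a b :=
        Set.Icc_subset_Icc (hx _).1 (hx _).2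
      refine exists_hasDerivAt_eq_zero (hmono i.castSucc_lt_succ) ?_ ?_ ?_ (f := g 0)
      · exact fun y hy => (hg 0 y (hsub hy)).continuousAt.continuousWithinAt
      · rw [h0, h0]
      · exact fun y hy => hg 0 y (hsub (Set.Ioo_subset_Icc_self hy))
    choose y hy hy0 using hR
    refine ih (fun k => g (k + 1)) (fun k => hg (k + 1)) y ?_ ?_ hy0
    · refine fun i j hij => (hy i).2.trans_le (le_trans ?_ (hy j).1.le)
      exact hmono.monotone (Fin.succ_le_castSucc_iff.2 hij)
    · exact fun i => ⟨(hx _).1.trans (hy i).1.le, (hy i).2.le.trans (hx _).2⟩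

/-- The error of Lagrange interpolation at a point `t`, in terms of the nodal polynomial and a
derivative of order the number of nodes. -/
theorem exists_interpolation_error {a b : ℝ} (n : ℕ) (f : ℕ → ℝ → ℝ)
    (hf : ∀ k, ∀ x ∈ Set.Icc a b, HasDerivAt (f k) (f (k + 1) x) x)
    (v : Fin n → ℝ) (hv : Function.Injective v) (hvab : ∀ i, v i ∈ Set.Icc a b)
    {t : ℝ} (ht : t ∈ Set.Icc a b) (htv : ∀ i, v i ≠ t) :
    ∃ ξ ∈ Set.Icc a b,
      f 0 t - (Lagrange.interpolate Finset.univ v (fun i => f 0 (v i))).eval t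
        = f n ξ / n.factorial * ∏ i, (t - v i) := by
  classical
  set p := Lagrange.interpolate Finset.univ v (fun i => f 0 (v i)) with hp
  set w := Lagrange.nodal Finset.univ v with hw
  have hwt : w.eval t ≠ 0 :=
    Lagrange.eval_nodal_not_at_node fun i _ => (htv i).symm
  set K := (f 0 t - p.eval t) / w.eval t with hK
  set g : ℕ → ℝ → ℝ := fun k x =>
    f k x - (Polynomial.derivative^[k] p).eval x - K * (Polynomial.derivative^[k] w).eval x with hg
  have hgd : ∀ k, ∀ x ∈ Set.Icc a b, HasDerivAt (g k) (g (k + 1) x) x := by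
    intro k x hx
    have h1 := (Polynomial.derivative^[k] p).hasDerivAt x
    have h2 := (Polynomial.derivative^[k] w).hasDerivAt x
    simp only [hg, Function.iterate_succ_apply']
    exact ((hf k x hx).sub h1).sub (h2.const_mul K)
  -- the `n + 1` zeros of `g 0`: the nodes and `t`
  set s : Finset ℝ := insert t (Finset.univ.image v) with hs
  have hcard : s.card = n + 1 := by
    rw [hs, Finset.card_insert_of_notMem, Finset.card_image_of_injective _ hv, Finset.card_univ,
      Fintype.card_fin]
    simpa using htv
  have hz : ∀ y ∈ s, y ∈ Set.Icc a b ∧ g 0 y = 0 := by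
    intro y hy
    rcases Finset.mem_insert.1 hy with rfl | hy
    · refine ⟨ht, ?_⟩
      simp only [hg, Function.iterate_zero, id]
      rw [hK, div_mul_cancel₀ _ hwt, sub_self]
    · obtain ⟨i, -, rfl⟩ := Finset.mem_image.1 hy
      refine ⟨hvab i, ?_⟩
      simp only [hg, Function.iterate_zero, id]
      rw [hw, Lagrange.eval_nodal_at_node (Finset.mem_univ i), hp,
        Lagrange.eval_interpolate_at_node _ hv.injOn (Finset.mem_univ i)]
      simp
  obtain ⟨ξ, hξ, h0⟩ := exists_iterated_hasDerivAt_eq_zero n g hgd (s.orderEmbOfFin hcard)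
    (s.orderEmbOfFin hcard).strictMono
    (fun i => (hz _ (s.orderEmbOfFin_mem hcard i)).1)
    (fun i => (hz _ (s.orderEmbOfFin_mem hcard i)).2)
  refine ⟨ξ, hξ, ?_⟩
  have hdp : Polynomial.derivative^[n] p = 0 := by
    by_cases hp0 : p = 0
    · rw [hp0, Polynomial.iterate_derivative_zero]
    · refine Polynomial.iterate_derivative_eq_zero ?_
      rw [Polynomial.natDegree_lt_iff_degree_lt hp0]
      have h1 := Lagrange.degree_interpolate_lt (s := Finset.univ) (fun i => f 0 (v i)) hv.injOn
      rwa [Finset.card_univ, Fintype.card_fin, ← hp] at h1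
  have hdw : (Polynomial.derivative^[n] w).eval ξ = n.factorial := by
    have hm : w.Monic := Lagrange.nodal_monic
    have hdeg : w.natDegree = n := by simp [hw, Lagrange.natDegree_nodal]
    have h1 := Polynomial.natDegree_iterate_derivative w n
    rw [hdeg, Nat.sub_self] at h1
    rw [Polynomial.eq_C_of_natDegree_le_zero h1, Polynomial.eval_C,
      Polynomial.coeff_iterate_derivative, zero_add, Nat.descFactorial_self]
    have h2 : w.coeff n = 1 := by
      rw [← hdeg]
      exact hm
    rw [h2, nsmul_eq_mul, mul_one]
  simp only [hg, hdp, hdw, Polynomial.eval_zero, sub_zero] at h0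
  have hfac : (n.factorial : ℝ) ≠ 0 := by positivity
  rw [← Lagrange.eval_nodal, ← hw, sub_eq_zero.1 h0, mul_div_cancel_right₀ _ hfac, hK,
    div_mul_cancel₀ _ hwt]

/-- The real part of the derivatives of a holomorphic function form a family of successive
derivatives along the real axis. -/
theorem hasDerivAt_re_iteratedDeriv {F : ℂ → ℂ} {U : Set ℂ} (hU : IsOpen U)
    (hF : DifferentiableOn ℂ F U) (k : ℕ) {x : ℝ} (hx : (x : ℂ) ∈ U) :
    HasDerivAt (fun y : ℝ => (iteratedDeriv k F y).re) (iteratedDeriv (k + 1) F x).re x := by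
  have han : AnalyticAt ℂ F x := hF.analyticAt (hU.mem_nhds hx)
  have h1 : AnalyticAt ℂ (iteratedDeriv k F) x := by
    rw [iteratedDeriv_eq_iterate]
    exact han.iterated_deriv k
  have h := h1.differentiableAt.hasDerivAt
  rw [← iteratedDeriv_succ] at h
  exact h.real_of_complex

/-- Interpolation error for a holomorphic function: if `F` is bounded by `C` on the discs of radius
`R` around the points of `[a, b]`, then Cauchy's estimate for the remainder gives the bound
`C R⁻ⁿ ∏ |t - v i|`. -/
theorem abs_interpolation_error_le {a b R C : ℝ} (hR : 0 < R) {F : ℂ → ℂ} {U : Set ℂ}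
    (hU : IsOpen U) (hF : DifferentiableOn ℂ F U)
    (hball : ∀ x ∈ Set.Icc a b, Metric.closedBall (x : ℂ) R ⊆ U)
    (hC : ∀ x ∈ Set.Icc a b, ∀ z ∈ Metric.closedBall (x : ℂ) R, ‖F z‖ ≤ C) {n : ℕ}
    (v : Fin n → ℝ) (hv : Function.Injective v) (hvab : ∀ i, v i ∈ Set.Icc a b)
    {t : ℝ} (ht : t ∈ Set.Icc a b) (htv : ∀ i, v i ≠ t) :
    |(Lagrange.interpolate Finset.univ v (fun i => (F (v i)).re)).eval t - (F t).re|
      ≤ C / R ^ n * ∏ i, |t - v i| := by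
  obtain ⟨ξ, hξ, h⟩ := exists_interpolation_error n (fun k y => (iteratedDeriv k F (y : ℂ)).re)
    (fun k x hx => hasDerivAt_re_iteratedDeriv hU hF k
      (hball x hx (Metric.mem_closedBall_self hR.le))) v hv hvab ht htv
  simp only [iteratedDeriv_zero] at h
  rw [abs_sub_comm, h, abs_mul, Finset.abs_prod]
  gcongr
  have hd : DiffContOnCl ℂ F (Metric.ball (ξ : ℂ) R) :=
    DifferentiableOn.diffContOnCl (hF.mono (by
      rw [closure_ball _ hR.ne']
      exact hball ξ hξ))
  have hc := Complex.norm_iteratedDeriv_le_of_forall_mem_sphere_norm_le n hR hd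
    (fun z hz => hC ξ hξ z (Metric.sphere_subset_closedBall hz))
  have hfac : (0 : ℝ) < n.factorial := by positivity
  rw [abs_div, abs_of_pos hfac, div_le_iff₀ hfac]
  refine (Complex.abs_re_le_norm _).trans (hc.trans (le_of_eq ?_))
  ring

/-! ### Interpolation at the Chebyshev nodes -/

/-- The angle of the `k`-th Chebyshev node. -/
noncomputable def chebAngle (n : ℕ) (k : Fin (n + 1)) : ℝ :=
  (2 * (k : ℝ) + 1) * Real.pi / (2 * ((n : ℝ) + 1))

theorem chebNode_eq (B : ℝ) (n : ℕ) (k : Fin (n + 1)) :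
    chebNode B n k = (B - 1) / 2 * Real.cos (chebAngle n k) + (B + 1) / 2 := rfl

theorem chebAngle_mem (n : ℕ) (k : Fin (n + 1)) : chebAngle n k ∈ Set.Ioo 0 Real.pi := by
  have hk : (k : ℝ) + 1 ≤ n + 1 := by exact_mod_cast k.isLt
  have hπ := Real.pi_pos
  constructor
  · unfold chebAngle
    positivity
  · rw [chebAngle, div_lt_iff₀ (by positivity)]
    nlinarith

theorem chebAngle_injective (n : ℕ) : Function.Injective (chebAngle n) := by
  intro i j h
  have hπ := Real.pi_pos
  unfold chebAngle at h
  field_simp at h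
  have h2 : (i : ℝ) = j := by linarith
  exact Fin.ext (by exact_mod_cast h2)

theorem cos_chebAngle_injective (n : ℕ) :
    Function.Injective fun k => Real.cos (chebAngle n k) := fun i j h =>
  chebAngle_injective n (Real.injOn_cos (Set.Ioo_subset_Icc_self (chebAngle_mem n i))
    (Set.Ioo_subset_Icc_self (chebAngle_mem n j)) h)

theorem chebNode_injective {B : ℝ} (hB : 1 < B) (n : ℕ) : Function.Injective (chebNode B n) := by
  intro i j h
  rw [chebNode_eq, chebNode_eq] at h
  refine cos_chebAngle_injective n ?_
  have h1 : (B - 1) / 2 ≠ 0 := by linarith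
  exact mul_left_cancel₀ h1 (add_right_cancel h)

theorem chebNode_mem {B : ℝ} (hB : 1 < B) (n : ℕ) (k : Fin (n + 1)) :
    chebNode B n k ∈ Set.Icc 1 B := by
  rw [chebNode_eq]
  constructor <;> nlinarith [Real.neg_one_le_cos (chebAngle n k), Real.cos_le_one (chebAngle n k)]

/-- The Chebyshev polynomial of degree `n + 1` is a multiple of the nodal polynomial of its roots,
the Chebyshev nodes. -/
theorem T_eq_nodal (n : ℕ) :
    Polynomial.Chebyshev.T ℝ ((n + 1 : ℕ) : ℤ)
      = Polynomial.C (2 ^ n) *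
        Lagrange.nodal Finset.univ (fun k => Real.cos (chebAngle n k)) := by
  have hdeg := Polynomial.Chebyshev.degree_T ℝ ((n + 1 : ℕ) : ℤ)
  have hlead := Polynomial.Chebyshev.leadingCoeff_T ℝ ((n + 1 : ℕ) : ℤ)
  simp only [Int.natAbs_natCast, Nat.add_sub_cancel] at hdeg hlead
  have hC : (2 ^ n : ℝ) ≠ 0 := by positivity
  have hnd : (Polynomial.C ((2 : ℝ) ^ n) *
        Lagrange.nodal Finset.univ (fun k => Real.cos (chebAngle n k))).degree = (n + 1 : ℕ) := by
    rw [Polynomial.degree_C_mul hC, Lagrange.degree_nodal]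
    simp
  refine Polynomial.eq_of_degree_le_of_eval_index_eq (v := fun k => Real.cos (chebAngle n k))
    Finset.univ (cos_chebAngle_injective n).injOn ?_ ?_ ?_ ?_
  · rw [hdeg]
    simp
  · rw [hdeg, hnd]
  · rw [hlead, Polynomial.leadingCoeff_mul, Polynomial.leadingCoeff_C,
      Lagrange.nodal_monic.leadingCoeff, mul_one]
  · intro k _
    rw [Polynomial.eval_mul, Lagrange.eval_nodal_at_node
        (v := fun k => Real.cos (chebAngle n k)) (Finset.mem_univ k), mul_zero,
      Polynomial.Chebyshev.T_real_cos, Real.cos_eq_zero_iff]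
    refine ⟨k, ?_⟩
    unfold chebAngle
    push_cast
    field_simp

/-- At the zeros of the Chebyshev polynomial `T` of degree `m`, its derivative `m U` is at least `m`
in absolute value, because `U (cos φ) sin φ = sin (m φ) = ±1` there. -/
theorem le_abs_eval_derivative_T (n : ℕ) (k : Fin (n + 1)) :
    ((n + 1 : ℕ) : ℝ) ≤ |(Polynomial.derivative
      (Polynomial.Chebyshev.T ℝ ((n + 1 : ℕ) : ℤ))).eval (Real.cos (chebAngle n k))| := by
  have hU := Polynomial.Chebyshev.U_real_cos (chebAngle n k) (n : ℤ)
  have hang : ((n : ℤ) + 1 : ℝ) * chebAngle n k = (k : ℕ) * Real.pi + Real.pi / 2 := by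
    unfold chebAngle
    push_cast
    field_simp
  have hsin : |Real.sin (((n : ℤ) + 1 : ℝ) * chebAngle n k)| = 1 := by
    rw [hang, Real.sin_add_pi_div_two, Real.cos_nat_mul_pi, abs_pow, abs_neg,
      abs_one, one_pow]
  rw [← hU, abs_mul] at hsin
  have h1 := Real.abs_sin_le_one (chebAngle n k)
  have h2 : 1 ≤ |(Polynomial.Chebyshev.U ℝ (n : ℤ)).eval (Real.cos (chebAngle n k))| := by
    nlinarith [abs_nonneg ((Polynomial.Chebyshev.U ℝ (n : ℤ)).eval (Real.cos (chebAngle n k)))]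
  rw [Polynomial.Chebyshev.T_derivative_eq_U]
  have h3 : ((n + 1 : ℕ) : ℤ) - 1 = n := by push_cast; ring
  rw [h3, Polynomial.eval_mul, abs_mul]
  have h4 : Polynomial.eval (Real.cos (chebAngle n k)) (((n + 1 : ℕ) : ℤ) : Polynomial ℝ)
      = ((n + 1 : ℕ) : ℝ) := by
    simp
  rw [h4, abs_of_nonneg (Nat.cast_nonneg _)]
  exact le_mul_of_one_le_right (Nat.cast_nonneg _) h2

theorem sqrt_gt_one {B : ℝ} (hB : 1 < B) : 1 < √B := by
  rwa [Real.lt_sqrt zero_le_one, one_pow]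

theorem one_lt_kappa {B : ℝ} (hB : 1 < B) : 1 < kappa B := by
  have h := sqrt_gt_one hB
  rw [kappa, one_lt_div (by linarith)]
  linarith

/-- Outside `[-1, 1]`, at the image `-(B + 1) / (B - 1)` of `0` under the map from `[1, B]` to
`[-1, 1]`, the Chebyshev polynomials are bounded by the powers of `κ`:
`(B + 1) / (B - 1) = cosh (log κ)`. -/
theorem abs_eval_T_le {B : ℝ} (hB : 1 < B) (m : ℕ) :
    |(Polynomial.Chebyshev.T ℝ (m : ℤ)).eval (-((B + 1) / (B - 1)))| ≤ kappa B ^ m := by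
  have hκ := one_lt_kappa hB
  have hκ0 : 0 < kappa B := by linarith
  have hcosh : (B + 1) / (B - 1) = Real.cosh (Real.log (kappa B)) := by
    rw [Real.cosh_log hκ0, kappa]
    have h := sqrt_gt_one hB
    have h1 : √B - 1 ≠ 0 := by linarith
    have h2 : √B + 1 ≠ 0 := by linarith
    have h3 : B - 1 ≠ 0 := by linarith
    have h4 : B = √B * √B := (Real.mul_self_sqrt (by linarith)).symm
    have h5 : √B * √B - 1 ≠ 0 := by rwa [← h4]
    have h6 : (B + 1) / (B - 1) = (√B * √B + 1) / (√B * √B - 1) := by rw [← h4]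
    rw [h6]
    have h7 : √B * √B - 1 = (√B - 1) * (√B + 1) := by ring
    rw [h7]
    field_simp
    ring
  have hneg : |(Polynomial.Chebyshev.T ℝ (m : ℤ)).eval (-((B + 1) / (B - 1)))|
      = |(Polynomial.Chebyshev.T ℝ (m : ℤ)).eval ((B + 1) / (B - 1))| := by
    rw [Polynomial.Chebyshev.T_eval_neg, abs_mul]
    simp
  rw [hneg, hcosh, Polynomial.Chebyshev.T_real_cosh, abs_of_pos (Real.cosh_pos _),
    Real.cosh_eq]
  have hl : 0 < Real.log (kappa B) := Real.log_pos hκ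
  have he : Real.exp (((m : ℤ) : ℝ) * Real.log (kappa B)) = kappa B ^ m := by
    rw [Int.cast_natCast, ← Real.log_pow, Real.exp_log (by positivity)]
  have hle : Real.exp (-(((m : ℤ) : ℝ) * Real.log (kappa B)))
      ≤ Real.exp (((m : ℤ) : ℝ) * Real.log (kappa B)) := by
    apply Real.exp_le_exp.2
    have : 0 ≤ ((m : ℤ) : ℝ) * Real.log (kappa B) := by
      rw [Int.cast_natCast]; positivity
    linarith
  rw [he] at hle
  rw [he]
  linarith

theorem eval_nodal_cos (n : ℕ) (y : ℝ) :
    (Lagrange.nodal Finset.univ (fun k => Real.cos (chebAngle n k))).eval y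
      = (Polynomial.Chebyshev.T ℝ ((n + 1 : ℕ) : ℤ)).eval y / 2 ^ n := by
  rw [T_eq_nodal, Polynomial.eval_mul, Polynomial.eval_C]
  field_simp

/-- The product of the Chebyshev nodes. -/
theorem prod_chebNode_le {B : ℝ} (hB : 1 < B) (n : ℕ) :
    ∏ k, |0 - chebNode B n k| ≤ 2 * ((B - 1) / 4 * kappa B) ^ (n + 1) := by
  have hB' : 0 < (B - 1) / 2 := by linarith
  have h1 : ∀ k, |0 - chebNode B n k|
      = (B - 1) / 2 * |-((B + 1) / (B - 1)) - Real.cos (chebAngle n k)| := by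
    intro k
    have hne : B - 1 ≠ 0 := by linarith
    have h : 0 - chebNode B n k
        = (B - 1) / 2 * (-((B + 1) / (B - 1)) - Real.cos (chebAngle n k)) := by
      rw [chebNode_eq]
      field_simp
      ring
    rw [h, abs_mul, abs_of_pos hB']
  rw [Finset.prod_congr rfl fun k _ => h1 k, Finset.prod_mul_distrib, Finset.prod_const,
    ← Finset.abs_prod, ← Lagrange.eval_nodal, eval_nodal_cos, abs_div, Finset.card_univ,
    Fintype.card_fin, abs_of_pos (show (0 : ℝ) < 2 ^ n by positivity)]
  have h2 := abs_eval_T_le hB (n + 1)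
  calc _ ≤ ((B - 1) / 2) ^ (n + 1) * (kappa B ^ (n + 1) / 2 ^ n) := by gcongr
    _ = 2 * ((B - 1) / 4 * kappa B) ^ (n + 1) := by
      have h4 : (B - 1) / 4 = (B - 1) / 2 / 2 := by ring
      rw [h4, mul_pow, div_pow ((B - 1) / 2), pow_succ (2 : ℝ)]
      field_simp

/-- The weights `γ j` of Richardson extrapolation at the Chebyshev nodes: the Lagrange basis
polynomials at `0`. -/
noncomputable def weight (B : ℝ) (n : ℕ) (j : Fin (n + 1)) : ℝ :=
  (Lagrange.basis Finset.univ (chebNode B n) j).eval 0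

theorem richardson_eq (B : ℝ) (n : ℕ) (y : Fin (n + 1) → ℝ) :
    richardson B n y = ∑ j, weight B n j * y j := by
  simp [richardson, weight, Lagrange.interpolate_apply, Polynomial.eval_finsetSum, mul_comm]

theorem weight_eq_eval_basis_cos {B : ℝ} (hB : 1 < B) (n : ℕ) (j : Fin (n + 1)) :
    weight B n j = (Lagrange.basis Finset.univ (fun k => Real.cos (chebAngle n k)) j).eval
      (-((B + 1) / (B - 1))) := by
  have hB' : B - 1 ≠ 0 := by linarith
  simp only [weight, Lagrange.basis, Polynomial.eval_prod, Lagrange.basisDivisor,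
    Polynomial.eval_mul, Polynomial.eval_C, Polynomial.eval_sub, Polynomial.eval_X]
  refine Finset.prod_congr rfl fun k hk => ?_
  have hne : Real.cos (chebAngle n j) - Real.cos (chebAngle n k) ≠ 0 :=
    sub_ne_zero.2 fun h => (Finset.ne_of_mem_erase hk) (cos_chebAngle_injective n h).symm
  rw [chebNode_eq, chebNode_eq]
  have h1 : (B - 1) / 2 * Real.cos (chebAngle n j) + (B + 1) / 2
      - ((B - 1) / 2 * Real.cos (chebAngle n k) + (B + 1) / 2)
      = (B - 1) / 2 * (Real.cos (chebAngle n j) - Real.cos (chebAngle n k)) := by ring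
  rw [h1]
  field_simp
  ring

/-- In terms of the Chebyshev polynomial `T` of degree `n + 1` and the point `y = -(B + 1) / (B - 1)`
that corresponds to `0`, the weight is `T(y) / ((y - y j) T'(y j))` with `y j` the `j`-th zero of `T`,
and `|y - y j| ≥ |y| - 1 = 2 / (B - 1)`. -/
theorem abs_weight_le {B : ℝ} (hB : 1 < B) (n : ℕ) (j : Fin (n + 1)) :
    |weight B n j| ≤ (B - 1) / 2 * kappa B ^ (n + 1) / (n + 1 : ℕ) := by
  have hB' : 0 < B - 1 := by linarith
  have hκ := one_lt_kappa hB
  have hκ0 : 0 < kappa B := by linarith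
  have hc1 := Real.neg_one_le_cos (chebAngle n j)
  have hdist : 2 / (B - 1) ≤ |-((B + 1) / (B - 1)) - Real.cos (chebAngle n j)| := by
    rw [abs_sub_comm]
    refine le_trans ?_ (le_abs_self _)
    have : (B + 1) / (B - 1) = 1 + 2 / (B - 1) := by
      field_simp
      ring
    linarith
  have hne : -((B + 1) / (B - 1)) ≠ Real.cos (chebAngle n j) := by
    intro h
    rw [h, sub_self, abs_zero] at hdist
    have : 0 < 2 / (B - 1) := by positivity
    linarith
  have hT : |(Lagrange.nodal Finset.univ (fun k => Real.cos (chebAngle n k))).eval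
      (-((B + 1) / (B - 1)))| ≤ kappa B ^ (n + 1) / 2 ^ n := by
    rw [eval_nodal_cos, abs_div, abs_of_pos (show (0 : ℝ) < 2 ^ n by positivity)]
    have h2 := abs_eval_T_le hB (n + 1)
    gcongr
  have hD : ((n + 1 : ℕ) : ℝ) / 2 ^ n ≤ |(Polynomial.derivative (Lagrange.nodal Finset.univ
      (fun k => Real.cos (chebAngle n k)))).eval (Real.cos (chebAngle n j))| := by
    have h := le_abs_eval_derivative_T n j
    rw [T_eq_nodal, Polynomial.derivative_C_mul, Polynomial.eval_mul, Polynomial.eval_C, abs_mul,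
      abs_of_pos (show (0 : ℝ) < 2 ^ n by positivity)] at h
    rwa [div_le_iff₀' (by positivity)]
  rw [weight_eq_eval_basis_cos hB, Lagrange.eval_basis_not_at_node (Finset.mem_univ j) hne,
    Lagrange.nodalWeight_eq_eval_derivative_nodal (Finset.mem_univ j), abs_mul, abs_mul, abs_inv,
    abs_inv]
  calc _ ≤ kappa B ^ (n + 1) / 2 ^ n * ((((n + 1 : ℕ) : ℝ) / 2 ^ n)⁻¹ * (2 / (B - 1))⁻¹) := by
        gcongr
    _ = _ := by field_simp

theorem sum_weight_sq_le {B : ℝ} (hB : 1 < B) (n : ℕ) :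
    ∑ j, weight B n j ^ 2 ≤ (B - 1) ^ 2 / 4 * kappa B ^ (2 * (n + 1)) := by
  have hκ := one_lt_kappa hB
  have hn : (1 : ℝ) ≤ (n + 1 : ℕ) := by exact_mod_cast Nat.le_add_left 1 n
  have h1 : ∀ j, weight B n j ^ 2
      ≤ (B - 1) ^ 2 / 4 * kappa B ^ (2 * (n + 1)) / (n + 1 : ℕ) := by
    intro j
    rw [← sq_abs]
    calc _ ≤ ((B - 1) / 2 * kappa B ^ (n + 1) / (n + 1 : ℕ)) ^ 2 := by
          gcongr
          exact abs_weight_le hB n j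
      _ = (B - 1) ^ 2 / 4 * kappa B ^ (2 * (n + 1)) / ((n + 1 : ℕ) * (n + 1 : ℕ)) := by ring
      _ ≤ _ := by
        gcongr
        exact le_mul_of_one_le_right (by positivity) hn
  refine (Finset.sum_le_sum fun j _ => h1 j).trans (le_of_eq ?_)
  rw [Finset.sum_const, Finset.card_univ, Fintype.card_fin, nsmul_eq_mul]
  field_simp

/-! ### The sampling error -/

/-- Hoeffding's two-sided tail bound, with the degenerate variance proxy `0` included. -/
theorem one_sub_le_measureReal_abs_lt {Ω : Type*} [MeasurableSpace Ω] {P : Measure Ω}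
    [IsProbabilityMeasure P] {Z : Ω → ℝ} {c : NNReal} (hZ : HasSubgaussianMGF Z c P)
    {t δ : ℝ} (ht : 0 < t) (hδ : 0 < δ) (h : 2 * c * Real.log (2 / δ) ≤ t ^ 2) :
    1 - δ ≤ P.real {ω | |Z ω| < t} := by
  rcases eq_or_ne c 0 with rfl | hc
  · have h0 := hZ.ae_eq_zero_of_hasSubgaussianMGF_zero
    have h1 : P {ω | |Z ω| < t} = 1 := by
      have h2 : {ω | |Z ω| < t} =ᵐ[P] Set.univ := by
        rw [Filter.eventuallyEq_univ]
        filter_upwards [h0] with ω hω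
        simpa [hω] using ht
      rw [measure_congr h2, measure_univ]
    rw [measureReal_def, h1]
    simp [hδ.le]
  · have hc0 : (0 : ℝ) < c := lt_of_le_of_ne c.2 (fun h => hc (NNReal.coe_eq_zero.1 h.symm))
    have hexp : Real.exp (-t ^ 2 / (2 * c)) ≤ δ / 2 := by
      rw [← Real.le_log_iff_exp_le (by positivity), div_le_iff₀ (by positivity)]
      have hl : Real.log (δ / 2) = -Real.log (2 / δ) := by
        rw [← Real.log_inv, inv_div]
      rw [hl]
      linarith
    have h1 := (hZ.measure_ge_le ht.le).trans hexp
    have h2 := (hZ.neg.measure_ge_le ht.le).trans hexp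
    have hcover : (Set.univ : Set Ω) ⊆
        {ω | |Z ω| < t} ∪ ({ω | t ≤ Z ω} ∪ {ω | t ≤ (-Z) ω}) := by
      intro ω _
      by_cases hω : |Z ω| < t
      · exact Or.inl hω
      · exact Or.inr (le_abs.1 (not_lt.1 hω))
    have h3 := measureReal_mono (μ := P) hcover
    have h4 := measureReal_union_le (μ := P) {ω | |Z ω| < t} ({ω | t ≤ Z ω} ∪ {ω | t ≤ (-Z) ω})
    have h5 := measureReal_union_le (μ := P) {ω | t ≤ Z ω} {ω | t ≤ (-Z) ω}
    rw [probReal_univ] at h3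
    linarith

variable {ι : Type*} [Fintype ι] [DecidableEq ι]

/-- Eigenvalues are bounded by the operator norm. -/
theorem abs_le_opNorm_of_mem_spectrum [Nonempty ι] {A : Matrix ι ι ℂ} {x : ℝ}
    (hx : x ∈ spectrum ℝ A) : |x| ≤ opNorm A := by
  have h1 : (x : ℂ) ∈ spectrum ℂ A := by
    rwa [← spectrum.algebraMap_mem_iff ℂ] at hx
  rw [← AlgEquiv.spectrum_eq (Matrix.toEuclideanCLM (𝕜 := ℂ) (n := ι)) A] at h1
  have h2 := spectrum.norm_le_norm_of_mem h1
  rwa [Complex.norm_real] at h2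

/-- The deviation of the Richardson estimate from the extrapolated exact values is sub-Gaussian,
with variance proxy `α² ∑ γ j ² / N`. -/
theorem hasSubgaussianMGF_richardson [Nonempty ι] {Ω : Type*} [MeasurableSpace Ω] {P : Measure Ω}
    [IsProbabilityMeasure P] (B : ℝ) {A : Matrix ι ι ℂ} {α : ℝ} (hA : opNorm A ≤ α)
    {n N : ℕ} {σ : Fin (n + 1) → Matrix ι ι ℂ} {X : Fin (n + 1) → Fin N → Ω → ℝ}
    (hX : IsShotRecord P A σ X) (hN : N ≠ 0) :
    ∃ c : NNReal, (c : ℝ) = α ^ 2 * (∑ j, weight B n j ^ 2) / N ∧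
      HasSubgaussianMGF (fun ω => richardson B n (fun j => sampleMean (fun i => X j i ω))
        - richardson B n (fun j => expect A (σ j))) c P := by
  have hα : 0 ≤ α := (norm_nonneg _).trans hA
  have hN' : (N : ℝ) ≠ 0 := by exact_mod_cast hN
  set c : Fin (n + 1) × Fin N → NNReal := fun p =>
    ⟨(weight B n p.1 / N) ^ 2, sq_nonneg _⟩ * (‖α - -α‖₊ / 2) ^ 2 with hc
  set Y : Fin (n + 1) × Fin N → Ω → ℝ := fun p ω =>
    weight B n p.1 / N * (X p.1 p.2 ω - ∫ ω, X p.1 p.2 ω ∂P) with hY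
  have hsub : ∀ p, HasSubgaussianMGF (Y p) (c p) P := by
    intro p
    refine (hasSubgaussianMGF_of_mem_Icc (hX.measurable p.1 p.2).aemeasurable ?_).const_mul _
    filter_upwards [hX.outcome p.1 p.2] with ω hω
    exact abs_le.1 ((abs_le_opNorm_of_mem_spectrum hω).trans hA)
  have hind : iIndepFun Y P :=
    hX.indep.comp (fun p x => weight B n p.1 / N * (x - ∫ ω, X p.1 p.2 ω ∂P))
      (fun p => by fun_prop)
  have hsum := HasSubgaussianMGF.sum_of_iIndepFun hind (s := Finset.univ) (fun p _ => hsub p)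
  refine ⟨_, ?_, hsum.congr (ae_of_all _ fun ω => ?_)⟩
  · have hc' : ∀ p, (c p : ℝ) = (weight B n p.1 / N) ^ 2 * α ^ 2 := by
      intro p
      have : |α - -α| / 2 = α := by
        rw [abs_of_nonneg (by linarith)]
        ring
      change (weight B n p.1 / N) ^ 2 * (|α - -α| / 2) ^ 2 = _
      rw [this]
    rw [NNReal.coe_sum, Finset.sum_congr rfl fun p _ => hc' p, Fintype.sum_prod_type]
    simp only [Finset.sum_const, Finset.card_univ, Fintype.card_fin, nsmul_eq_mul]
    rw [Finset.mul_sum, Finset.sum_div]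
    refine Finset.sum_congr rfl fun j _ => ?_
    field_simp
  · simp only [hY, hX.mean]
    rw [Fintype.sum_prod_type, richardson_eq, richardson_eq, ← Finset.sum_sub_distrib]
    refine Finset.sum_congr rfl fun j _ => ?_
    dsimp only
    rw [← Finset.mul_sum, Finset.sum_sub_distrib, Finset.sum_const, Finset.card_univ,
      Fintype.card_fin, nsmul_eq_mul, sampleMean]
    field_simp

/-! ### Evolutions whose generator is a power series -/

section Evolution

variable {E : Type*} [NormedAddCommGroup E] [NormedSpace ℂ E]

theorem norm_exp_le (S : E →L[ℂ] E) : ‖NormedSpace.exp S‖ ≤ Real.exp ‖S‖ := by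
  have hpow : ∀ n : ℕ, ‖S ^ n‖ ≤ ‖S‖ ^ n := by
    intro n
    rcases Nat.eq_zero_or_pos n with rfl | hn
    · rw [pow_zero, pow_zero]
      exact ContinuousLinearMap.norm_id_le
    · exact norm_pow_le' S hn
  have hs := NormedSpace.expSeries_div_hasSum_exp ‖S‖
  rw [← Real.exp_eq_exp_ℝ] at hs
  rw [NormedSpace.exp_eq_tsum ℂ]
  refine tsum_of_norm_bounded hs fun n => ?_
  rw [norm_smul, norm_inv, Complex.norm_natCast, inv_mul_eq_div]
  gcongr
  exact hpow n

/-- The value at `z` of the power series with coefficients `Λ j`. -/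
noncomputable def generator (Λ : ℕ → E →L[ℂ] E) (z : ℂ) : E →L[ℂ] E := ∑' j, z ^ j • Λ j

variable {Λ : ℕ → E →L[ℂ] E} {θ : ℝ}

theorem norm_generator_term_le (hΛ : ∀ j, ‖Λ j‖ ≤ θ ^ j) {z : ℂ} {s : ℝ} (hz : ‖z‖ ≤ s) (j : ℕ) :
    ‖z ^ j • Λ j‖ ≤ (s * θ) ^ j := by
  rw [norm_smul, norm_pow, mul_pow]
  have hs : 0 ≤ s := (norm_nonneg _).trans hz
  gcongr
  exact hΛ j

theorem norm_generator_le (hΛ : ∀ j, ‖Λ j‖ ≤ θ ^ j) (hθ : 0 < θ) {z : ℂ} {s : ℝ} (hz : ‖z‖ ≤ s)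
    (hs : s * θ < 1) : ‖generator Λ z‖ ≤ (1 - s * θ)⁻¹ :=
  have hs0 : 0 ≤ s := (norm_nonneg _).trans hz
  tsum_of_norm_bounded (hasSum_geometric_of_lt_one (by positivity) hs)
    (norm_generator_term_le hΛ hz)

/-- The expectation value `φ (exp (T G(z)) v)` at time `T`, as a function of the complex noise level
`z`, for the power series generator `G`. -/
noncomputable def evolvedValue (Λ : ℕ → E →L[ℂ] E) (T : ℝ) (v : E) (φ : E →L[ℂ] ℂ) (z : ℂ) : ℂ :=
  φ (NormedSpace.exp ((T : ℂ) • generator Λ z) v)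

theorem norm_evolvedValue_le (hΛ : ∀ j, ‖Λ j‖ ≤ θ ^ j) (hθ : 0 < θ) {T α : ℝ} (hT : 0 ≤ T) {v : E}
    (hv : ‖v‖ ≤ 1) {φ : E →L[ℂ] ℂ} (hφ : ‖φ‖ ≤ α) {z : ℂ} {s : ℝ} (hz : ‖z‖ ≤ s)
    (hs : s * θ < 1) : ‖evolvedValue Λ T v φ z‖ ≤ α * Real.exp (T / (1 - s * θ)) := by
  have hexp : ‖NormedSpace.exp ((T : ℂ) • generator Λ z)‖ ≤ Real.exp (T / (1 - s * θ)) := by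
    refine (norm_exp_le _).trans (Real.exp_le_exp.2 ?_)
    rw [norm_smul, Complex.norm_real, Real.norm_of_nonneg hT, div_eq_mul_inv]
    exact mul_le_mul_of_nonneg_left (norm_generator_le hΛ hθ hz hs) hT
  have hα : 0 ≤ α := (norm_nonneg _).trans hφ
  calc ‖evolvedValue Λ T v φ z‖
      ≤ ‖φ‖ * ‖NormedSpace.exp ((T : ℂ) • generator Λ z) v‖ := φ.le_opNorm _
    _ ≤ ‖φ‖ * (‖NormedSpace.exp ((T : ℂ) • generator Λ z)‖ * ‖v‖) := by
      gcongr
      exact ContinuousLinearMap.le_opNorm _ _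
    _ ≤ α * (Real.exp (T / (1 - s * θ)) * 1) := by gcongr
    _ = _ := by rw [mul_one]

variable [CompleteSpace E]

theorem hasSum_generator (hΛ : ∀ j, ‖Λ j‖ ≤ θ ^ j) (hθ : 0 < θ) {z : ℂ} (hz : ‖z‖ * θ < 1) :
    HasSum (fun j => z ^ j • Λ j) (generator Λ z) :=
  (Summable.of_norm_bounded (summable_geometric_of_lt_one (by positivity) hz)
    (norm_generator_term_le hΛ le_rfl)).hasSum

theorem differentiableOn_generator (hΛ : ∀ j, ‖Λ j‖ ≤ θ ^ j) (hθ : 0 < θ) :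
    DifferentiableOn ℂ (generator Λ) (Metric.ball 0 (1 / θ)) := by
  intro z hz
  rw [mem_ball_zero_iff] at hz
  obtain ⟨s, hzs, hs⟩ := exists_between hz
  have hs0 : 0 < s := (norm_nonneg _).trans_lt hzs
  have h := Complex.differentiableOn_tsum_of_summable_norm
    (F := fun (j : ℕ) (w : ℂ) => w ^ j • Λ j) (U := Metric.ball 0 s)
    (summable_geometric_of_lt_one (by positivity) ((lt_div_iff₀ hθ).1 hs))
    (fun j => by fun_prop) Metric.isOpen_ball
    (fun j w hw => norm_generator_term_le hΛ (mem_ball_zero_iff.1 hw).le j)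
  exact ((h z (by simpa using hzs)).differentiableAt
    (Metric.isOpen_ball.mem_nhds (by simpa using hzs))).differentiableWithinAt

theorem differentiableOn_evolvedValue (hΛ : ∀ j, ‖Λ j‖ ≤ θ ^ j) (hθ : 0 < θ) (T : ℝ) (v : E)
    (φ : E →L[ℂ] ℂ) :
    DifferentiableOn ℂ (evolvedValue Λ T v φ) (Metric.ball 0 (1 / θ)) := by
  intro z hz
  have h1 : DifferentiableAt ℂ (NormedSpace.exp : (E →L[ℂ] E) → (E →L[ℂ] E))
      ((T : ℂ) • generator Λ z) :=
    (NormedSpace.exp_analytic (𝕂 := ℂ) _).differentiableAt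
  have h2 : DifferentiableWithinAt ℂ (fun w => (T : ℂ) • generator Λ w) (Metric.ball 0 (1 / θ)) z :=
    (differentiableOn_generator hΛ hθ z hz).const_smul (T : ℂ)
  have h3 := h1.comp_differentiableWithinAt z h2
  exact φ.differentiableAt.comp_differentiableWithinAt z
    (h3.clm_apply (differentiableWithinAt_const v))

/-- The solution of a linear differential equation with constant coefficients is given by the
exponential of the generator. -/
theorem eq_exp_apply_of_hasDerivWithinAt {T : ℝ} (hT : 0 ≤ T) (S : E →L[ℂ] E) {y : ℝ → E}
    (hy : ∀ t ∈ Set.Icc 0 T, HasDerivWithinAt y (S (y t)) (Set.Icc 0 T) t) :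
    y T = NormedSpace.exp ((T : ℂ) • S) (y 0) := by
  have hS : LipschitzWith ‖S‖₊ S := S.lipschitz
  have hg : ∀ t : ℝ, HasDerivAt (fun t : ℝ => NormedSpace.exp ((t : ℂ) • S) (y 0))
      (S (NormedSpace.exp ((t : ℂ) • S) (y 0))) t := by
    intro t
    have h1 : HasDerivAt (fun u : ℂ => NormedSpace.exp (u • S) (y 0))
        (S (NormedSpace.exp ((t : ℂ) • S) (y 0))) (t : ℂ) := by
      have h2 := hasDerivAt_exp_smul_const' (𝕂 := ℂ) S (t : ℂ)
      have h3 := h2.clm_apply (hasDerivAt_const (t : ℂ) (y 0))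
      simpa using h3
    have h2 := HasDerivAt.scomp t h1 Complex.ofRealCLM.hasDerivAt
    rw [Complex.ofRealCLM_apply, Complex.ofReal_one, one_smul] at h2
    exact h2
  have h := ODE_solution_unique (v := fun _ => S) (K := ‖S‖₊) (f := y)
    (g := fun t : ℝ => NormedSpace.exp ((t : ℂ) • S) (y 0)) (a := 0) (b := T) (fun _ => hS)
    (fun t ht => (hy t ht).continuousWithinAt)
    (fun t ht => (hy t (Set.Ico_subset_Icc_self ht)).mono_of_mem_nhdsWithin
      (Icc_mem_nhdsGE_of_mem ht))
    (fun t _ => (hg t).continuousAt.continuousWithinAt)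
    (fun t _ => (hg t).hasDerivWithinAt) (by simp)
  exact h (Set.right_mem_Icc.2 hT)

end Evolution

/-! ### The modified Lindblad equation -/

section Superoperators

variable {ι : Type*} [Fintype ι]

theorem unitaryPart_add (H X Y : Matrix ι ι ℂ) :
    unitaryPart H (X + Y) = unitaryPart H X + unitaryPart H Y := by
  simp only [unitaryPart, mul_add, add_mul, ← smul_add]
  congr 1
  abel

theorem unitaryPart_smul (H : Matrix ι ι ℂ) (c : ℂ) (X : Matrix ι ι ℂ) :
    unitaryPart H (c • X) = c • unitaryPart H X := by
  simp only [unitaryPart, Matrix.mul_smul, Matrix.smul_mul, ← smul_sub]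
  rw [smul_comm]

theorem dissipator_add {m : ℕ} (V : Fin m → Matrix ι ι ℂ) (X Y : Matrix ι ι ℂ) :
    dissipator V (X + Y) = dissipator V X + dissipator V Y := by
  simp only [dissipator, ← Finset.sum_add_distrib]
  refine Finset.sum_congr rfl fun j _ => ?_
  simp only [mul_add, add_mul, smul_add]
  abel

theorem dissipator_smul {m : ℕ} (V : Fin m → Matrix ι ι ℂ) (c : ℂ) (X : Matrix ι ι ℂ) :
    dissipator V (c • X) = c • dissipator V X := by
  simp only [dissipator, Finset.smul_sum]
  refine Finset.sum_congr rfl fun j _ => ?_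
  simp only [Matrix.mul_smul, Matrix.smul_mul, smul_sub, smul_add, smul_comm c (1 / 2 : ℂ)]

end Superoperators

section Lindblad

variable {ι : Type*} [Fintype ι] [DecidableEq ι]

open TraceClass

theorem Model.coeff_add (M : Model ι) (c : ℝ) (j : ℕ) (X Y : Matrix ι ι ℂ) :
    M.coeff c j (X + Y) = M.coeff c j X + M.coeff c j Y := by
  match j with
  | 0 => exact unitaryPart_add _ _ _
  | 1 =>
    simp only [Model.coeff, unitaryPart_add, dissipator_add, smul_add]
    abel
  | j + 2 => simp only [Model.coeff, unitaryPart_add, smul_add]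

theorem Model.coeff_smul (M : Model ι) (c : ℝ) (j : ℕ) (a : ℂ) (X : Matrix ι ι ℂ) :
    M.coeff c j (a • X) = a • M.coeff c j X := by
  match j with
  | 0 => exact unitaryPart_smul _ _ _
  | 1 => simp only [Model.coeff, unitaryPart_smul, dissipator_smul, smul_add, smul_comm a]
  | j + 2 => simp only [Model.coeff, unitaryPart_smul, smul_comm a]

/-- The coefficient `𝓛_j` as a linear map on the matrices with the trace norm. -/
noncomputable def Model.coeffLin (M : Model ι) (c : ℝ) (j : ℕ) :
    TraceClass ι →ₗ[ℂ] TraceClass ι where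
  toFun X := ofMatrix (M.coeff c j (ofMatrix.symm X))
  map_add' X Y := by rw [map_add, M.coeff_add, map_add]
  map_smul' a X := by rw [map_smul, M.coeff_smul, map_smul, RingHom.id_apply]

/-- The coefficient `𝓛_j` as a bounded operator on the matrices with the trace norm. -/
noncomputable def Model.coeffCLM (M : Model ι) (c : ℝ) (j : ℕ) : TraceClass ι →L[ℂ] TraceClass ι :=
  LinearMap.toContinuousLinearMap (M.coeffLin c j)

theorem Model.norm_coeffCLM_le (M : Model ι) (c : ℝ) {θ : ℝ} (hθ : 0 < θ) {j : ℕ}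
    (h : InducedNormLE (M.coeff c j) (θ ^ j)) : ‖M.coeffCLM c j‖ ≤ θ ^ j :=
  ContinuousLinearMap.opNorm_le_bound _ (by positivity) fun X => h (ofMatrix.symm X)

/-- The functional `X ↦ tr (X A)`. -/
noncomputable def traceMul (A : Matrix ι ι ℂ) : TraceClass ι →L[ℂ] ℂ :=
  LinearMap.toContinuousLinearMap
    { toFun := fun X => (ofMatrix.symm X * A).trace
      map_add' := fun X Y => by rw [map_add, add_mul, Matrix.trace_add]
      map_smul' := fun a X => by
        rw [map_smul, Matrix.smul_mul, Matrix.trace_smul, RingHom.id_apply] }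

theorem traceMul_apply (A : Matrix ι ι ℂ) (X : TraceClass ι) :
    traceMul A X = (ofMatrix.symm X * A).trace := rfl

theorem norm_traceMul_le (A : Matrix ι ι ℂ) : ‖traceMul A‖ ≤ opNorm A :=
  ContinuousLinearMap.opNorm_le_bound _ (opNorm_nonneg A) fun X => by
    rw [mul_comm]
    exact norm_trace_mul_le _ _

/-- The identity map to the trace norm, as a homeomorphism. -/
noncomputable def ofMatrixCLE : Matrix ι ι ℂ ≃L[ℂ] TraceClass ι :=
  LinearEquiv.toContinuousLinearEquiv ofMatrix

/-- Differentiability does not depend on the choice between the entrywise topology and the trace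
norm. -/
theorem hasDerivWithinAt_ofMatrix {y : ℝ → Matrix ι ι ℂ} {y' : Matrix ι ι ℂ} {s : Set ℝ} {t : ℝ}
    (h : HasDerivWithinAt y y' s t) :
    HasDerivWithinAt (fun u => ofMatrix (y u)) (ofMatrix y') s t := by
  let _ : NormedAddCommGroup (Matrix ι ι ℂ) := Matrix.normedAddCommGroup
  let _ : NormedSpace ℝ (Matrix ι ι ℂ) := Matrix.normedSpace
  exact ((ofMatrixCLE (ι := ι)).toContinuousLinearMap.restrictScalars ℝ).hasFDerivAt
    |>.comp_hasDerivWithinAt t h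

theorem Model.hasSum_coeff (M : Model ι) {c θ lam : ℝ} (hθ : 0 < θ)
    (hM : ∀ j, InducedNormLE (M.coeff c j) (θ ^ j)) (hlam : 0 ≤ lam) (hlamθ : lam * θ < 1)
    (X : Matrix ι ι ℂ) :
    HasSum (fun j => (lam : ℂ) ^ j • M.coeff c j X)
      (ofMatrix.symm (generator (M.coeffCLM c) (lam : ℂ) (ofMatrix X))) := by
  have hz : ‖(lam : ℂ)‖ * θ < 1 := by
    rwa [Complex.norm_real, Real.norm_of_nonneg hlam]
  have h1 := (ContinuousLinearMap.apply ℂ (TraceClass ι) (ofMatrix X)).hasSum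
    (hasSum_generator (fun j => M.norm_coeffCLM_le c hθ (hM j)) hθ hz)
  have h2 := h1.map (ofMatrixCLE (ι := ι)).symm (ofMatrixCLE (ι := ι)).symm.continuous
  exact h2

/-- Along the curve `lam = c τ²`, the right-hand side of the modified Lindblad equation is the power
series with the coefficients `𝓛_j`. -/
theorem Model.ofMatrix_rhs (M : Model ι) {c θ lam : ℝ} (hc : 0 < c) (hθ : 0 < θ)
    (hM : ∀ j, InducedNormLE (M.coeff c j) (θ ^ j)) (hlam : 0 ≤ lam) (hlamθ : lam * θ < 1)
    (X : Matrix ι ι ℂ) :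
    ofMatrix (M.rhs (Model.stepSize c lam) lam X)
      = generator (M.coeffCLM c) (lam : ℂ) (ofMatrix X) := by
  have hpow : ∀ ℓ : ℕ, (Model.stepSize c lam ^ (2 * (ℓ + 1)) : ℝ)
      = lam ^ (ℓ + 1) * c⁻¹ ^ (ℓ + 1) := by
    intro ℓ
    rw [Model.stepSize, pow_mul, Real.sq_sqrt (by positivity), div_eq_mul_inv, mul_pow]
  have h1 := M.hasSum_coeff hθ hM hlam hlamθ X
  generalize hS : generator (M.coeffCLM c) (lam : ℂ) (ofMatrix X) = S at h1 ⊢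
  set b : ℕ → Matrix ι ι ℂ := fun ℓ =>
    ((Model.stepSize c lam ^ (2 * (ℓ + 1)) : ℝ) : ℂ) • unitaryPart (M.Ht (ℓ + 1)) X with hb
  have h2 := (hasSum_nat_add_iff' 2).2 h1
  have h3 : HasSum (fun j => b (j + 1)) (ofMatrix.symm S - (unitaryPart M.H X
      + ((lam : ℂ) • dissipator M.V X + b 0))) := by
    convert! h2 using 1
    · funext j
      simp only [hb, hpow, Model.coeff, smul_smul]
      push_cast
      rfl
    · rw [Finset.sum_range_succ, Finset.sum_range_one]
      simp only [hb, hpow, Model.coeff, smul_add, smul_smul]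
      simp
  have h4 := (hasSum_nat_add_iff 1).1 h3
  rw [Finset.sum_range_one] at h4
  have h5 : M.rhs (Model.stepSize c lam) lam X = ofMatrix.symm S := by
    rw [Model.rhs, h4.tsum_eq]
    abel
  rw [h5, LinearEquiv.apply_symm_apply]

/-- The solution of the modified Lindblad equation at time `T` is the exponential of the power
series generator, applied to the initial state. -/
theorem Model.IsSolution.ofMatrix_jointState {M : Model ι} {c θ B T lam : ℝ}
    {ρ : ℝ → ℝ → ℝ → Matrix ι ι ℂ} (hρ : M.IsSolution c B T ρ) (hc : 0 < c) (hθ : 0 < θ)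
    (hT : 0 ≤ T) (hM : ∀ j, InducedNormLE (M.coeff c j) (θ ^ j)) (hlam : lam ∈ Set.Icc 0 B)
    (hlamθ : lam * θ < 1) :
    ofMatrix (jointState c T ρ lam)
      = NormedSpace.exp ((T : ℂ) • generator (M.coeffCLM c) lam) (ofMatrix M.init) := by
  obtain ⟨h0, hd⟩ := hρ lam hlam
  have h := eq_exp_apply_of_hasDerivWithinAt hT (generator (M.coeffCLM c) lam)
    (y := fun s => ofMatrix (ρ s (Model.stepSize c lam) lam)) (fun t ht => by
      rw [← M.ofMatrix_rhs hc hθ hM hlam.1 hlamθ]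
      exact hasDerivWithinAt_ofMatrix (hd t ht))
  rw [h0] at h
  exact h

/-- The expectation value in the joint state is the restriction to real noise levels of a function
that is holomorphic in the noise level. -/
theorem expect_jointState {M : Model ι} {c θ B T lam : ℝ}
    {ρ : ℝ → ℝ → ℝ → Matrix ι ι ℂ} (hρ : M.IsSolution c B T ρ) (hc : 0 < c) (hθ : 0 < θ)
    (hT : 0 ≤ T) (hM : ∀ j, InducedNormLE (M.coeff c j) (θ ^ j)) (hlam : lam ∈ Set.Icc 0 B)
    (hlamθ : lam * θ < 1) (A : Matrix ι ι ℂ) :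
    expect A (jointState c T ρ lam)
      = (evolvedValue (M.coeffCLM c) T (ofMatrix M.init) (traceMul A) lam).re := by
  rw [evolvedValue, ← hρ.ofMatrix_jointState hc hθ hT hM hlam hlamθ, traceMul_apply,
    LinearEquiv.symm_apply_apply, expect]

end Lindblad

/-! ### Bias and sampling error of the extrapolated value -/

section Extrapolation

variable {ι : Type*} [Fintype ι] [DecidableEq ι]

/-- The bias of Richardson extrapolation decays geometrically. The parameter `s` measures how much
of the disc of analyticity beyond `lam` is used in Cauchy's estimate. -/
theorem abs_richardson_expect_sub_le {B θ lam s c T α : ℝ} (hB : 1 < B) (hθ : 0 < θ)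
    (hlam : B ≤ lam) (hlamθ : lam * θ < 1) (hs0 : 0 < s) (hs1 : s < 1) (hc : 0 < c) (hT : 0 ≤ T)
    {M : Model ι} {ρ : ℝ → ℝ → ℝ → Matrix ι ι ℂ} {A : Matrix ι ι ℂ}
    (hM : ∀ j, InducedNormLE (M.coeff c j) (θ ^ j)) (hρ : M.IsSolution c B T ρ)
    (hA : opNorm A ≤ α) (n : ℕ) :
    |richardson B n (fun j => expect A (jointState c T ρ (chebNode B n j)))
        - expect A (jointState c T ρ 0)|
      ≤ 2 * (α * Real.exp (T / ((1 - lam * θ) * (1 - s))))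
        * ((B - 1) * kappa B * θ / (4 * (s * (1 - lam * θ)))) ^ (n + 1) := by
  have hgap : 0 < 1 - lam * θ := by linarith
  set R := s * (1 - lam * θ) / θ with hR
  have hR0 : 0 < R := by positivity
  have hRθ : R * θ = s * (1 - lam * θ) := div_mul_cancel₀ _ hθ.ne'
  have hden : 1 - (lam + R) * θ = (1 - lam * θ) * (1 - s) := by
    rw [add_mul, hRθ]
    ring
  have hlt : (lam + R) * θ < 1 := by
    have : 0 < (1 - lam * θ) * (1 - s) := mul_pos hgap (by linarith)
    linarith
  have hnorm : ∀ x ∈ Set.Icc 0 B, ∀ z ∈ Metric.closedBall (x : ℂ) R, ‖z‖ ≤ lam + R := by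
    intro x hx z hz
    rw [mem_closedBall_iff_norm] at hz
    have h1 := norm_le_norm_add_norm_sub' z (x : ℂ)
    rw [Complex.norm_real, Real.norm_of_nonneg hx.1] at h1
    linarith [hx.2]
  have hlamx : ∀ x ∈ Set.Icc 0 B, x * θ < 1 := fun x hx =>
    lt_of_le_of_lt (mul_le_mul_of_nonneg_right (hx.2.trans hlam) hθ.le) hlamθ
  have hΛ : ∀ j, ‖M.coeffCLM c j‖ ≤ θ ^ j := fun j => M.norm_coeffCLM_le c hθ (hM j)
  have h0 : (0 : ℝ) ∈ Set.Icc 0 B := ⟨le_rfl, by linarith⟩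
  have hnode : ∀ j, chebNode B n j ∈ Set.Icc 0 B := fun j =>
    ⟨zero_le_one.trans (chebNode_mem hB n j).1, (chebNode_mem hB n j).2⟩
  have hval := fun x hx => expect_jointState hρ hc hθ hT hM (lam := x) hx (hlamx x hx) A
  have h := abs_interpolation_error_le (a := 0) (b := B) hR0 Metric.isOpen_ball
    (differentiableOn_evolvedValue hΛ hθ T (TraceClass.ofMatrix M.init) (traceMul A))
    (fun x hx z hz => by
      rw [mem_ball_zero_iff, lt_div_iff₀ hθ]
      exact lt_of_le_of_lt (mul_le_mul_of_nonneg_right (hnorm x hx z hz) hθ.le) hlt)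
    (fun x hx z hz => norm_evolvedValue_le hΛ hθ hT M.init_density.traceNorm_le_one
      ((norm_traceMul_le A).trans hA) (hnorm x hx z hz) hlt)
    (chebNode B n) (chebNode_injective hB n) hnode h0
    (fun j => (zero_lt_one.trans_le (chebNode_mem hB n j).1).ne')
  rw [hval 0 h0, funext fun j => hval _ (hnode j), richardson]
  refine h.trans ?_
  have hα : 0 ≤ α := (opNorm_nonneg A).trans hA
  rw [hden]
  calc _ ≤ α * Real.exp (T / ((1 - lam * θ) * (1 - s))) / R ^ (n + 1)
        * (2 * ((B - 1) / 4 * kappa B) ^ (n + 1)) := by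
        gcongr
        exact prod_chebNode_le hB n
    _ = 2 * (α * Real.exp (T / ((1 - lam * θ) * (1 - s))))
        * ((B - 1) / 4 * kappa B / R) ^ (n + 1) := by
        rw [div_pow ((B - 1) / 4 * kappa B) R]
        ring
    _ = _ := by
        congr 2
        rw [hR]
        field_simp

/-- If the bias is below `ε / 2` and the number `N` of shots per node is large compared with the
amplification factor `∑ γ j ²` of the sampling variance, then the estimate is within `ε` of the
target `x` with probability at least `1 - δ`. The assumption `hN` excludes that `N = 0` unless the
outcomes vanish. -/
theorem one_sub_le_measureReal_richardson_lt [Nonempty ι] {Ω : Type*} [MeasurableSpace Ω]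
    {P : Measure Ω} [IsProbabilityMeasure P] {B : ℝ} {A : Matrix ι ι ℂ} {α : ℝ}
    (hA : opNorm A ≤ α) {n N : ℕ} {σ : Fin (n + 1) → Matrix ι ι ℂ}
    {X : Fin (n + 1) → Fin N → Ω → ℝ} (hX : IsShotRecord P A σ X) {ε δ x : ℝ} (hε : 0 < ε)
    (hδ : 0 < δ) (hbias : |richardson B n (fun j => expect A (σ j)) - x| < ε / 2)
    (hN : N = 0 → α = 0)
    (hNS : 8 * α ^ 2 * (∑ j, weight B n j ^ 2) * Real.log (2 / δ) ≤ N * ε ^ 2) :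
    1 - δ ≤ P.real {ω | |richardson B n (fun j => sampleMean (fun i => X j i ω)) - x| < ε} := by
  rcases eq_or_ne N 0 with rfl | hN0
  · -- without shots the sample means are `0` by convention, which is exact because `A = 0`
    have hA0 : A = 0 := by
      have h1 : opNorm A = 0 := le_antisymm (hA.trans (hN rfl).le) (opNorm_nonneg A)
      exact (map_eq_zero_iff _ (Matrix.toEuclideanCLM (𝕜 := ℂ) (n := ι)).injective).1
        (norm_eq_zero.1 h1)
    have h1 : {ω | |richardson B n (fun j => sampleMean (fun i => X j i ω)) - x| < ε}
        = Set.univ := by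
      ext ω
      simp only [Set.mem_ofPred_eq, Set.mem_univ, iff_true]
      have h2 : (fun j => sampleMean (fun i => X j i ω)) = fun j => expect A (σ j) := by
        funext j
        simp [sampleMean, expect, hA0]
      rw [h2]
      linarith
    rw [h1, probReal_univ]
    linarith
  · obtain ⟨c, hc, hsub⟩ := hasSubgaussianMGF_richardson B hA hX hN0
    have hN1 : (0 : ℝ) < N := by exact_mod_cast Nat.pos_of_ne_zero hN0
    have h1 := one_sub_le_measureReal_abs_lt hsub (half_pos hε) hδ (by
      rw [hc, mul_div_assoc', div_mul_eq_mul_div, div_le_iff₀ hN1]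
      linarith)
    refine h1.trans (measureReal_mono fun ω hω => ?_)
    have h2 := abs_lt.1 (show |richardson B n (fun j => sampleMean (fun i => X j i ω))
        - richardson B n (fun j => expect A (σ j))| < ε / 2 from hω)
    have h3 := abs_lt.1 hbias
    change |richardson B n (fun j => sampleMean (fun i => X j i ω)) - x| < ε
    rw [abs_lt]
    constructor <;> linarith [h2.1, h2.2, h3.1, h3.2]

theorem Model.nonempty (M : Model ι) : Nonempty ι := by
  by_contra h
  rw [not_nonempty_iff] at h
  have h1 := M.init_density.2
  simp [Matrix.trace] at h1

end Extrapolation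

/-! ### The choice of constants -/

theorem rate_pos {B θ lam : ℝ} (hB : 1 < B) (hθ : 0 < θ) (hlamθ : lam * θ < 1) :
    0 < rate B θ lam := by
  have h1 : 0 < 1 - lam * θ := by linarith
  have h2 : 0 < B - 1 := by linarith
  have h3 := one_lt_kappa hB
  unfold rate
  positivity

/-- With `s = e^(-1/2) / κ` the geometric rate of the bias is `e^(-1/2) r`. -/
theorem bias_rate_eq {B θ lam : ℝ} (hB : 1 < B) (hlamθ : lam * θ < 1) :
    (B - 1) * kappa B * θ / (4 * (Real.exp (-(1 / 2)) / kappa B * (1 - lam * θ)))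
      = rate B θ lam * Real.exp (-(1 / 2)) := by
  have h1 : 1 - lam * θ ≠ 0 := by linarith
  have h3 : kappa B ≠ 0 := by linarith [one_lt_kappa hB]
  have h4 : Real.exp 1 = (Real.exp (-(1 / 2)) * Real.exp (-(1 / 2)))⁻¹ := by
    rw [← Real.exp_add, ← Real.exp_neg]
    norm_num
  rw [rate, h4]
  field_simp

/-- A geometric sequence of ratio `r e^(-1/2)` is below `ε` times its `k`-th term from the index
`log (1/ε) / (log (1/r) + 1/2) + k` on. -/
theorem pow_le_mul_pow_of_le {r ε : ℝ} (hr0 : 0 < r) (hr1 : r < 1) (hε : 0 < ε) {n k : ℕ}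
    (hn : -Real.log r / (-Real.log r + 1 / 2) * (Real.log ε / Real.log r) + k ≤ n) :
    (r * Real.exp (-(1 / 2))) ^ n ≤ ε * (r * Real.exp (-(1 / 2))) ^ k := by
  have hl : Real.log r < 0 := Real.log_neg hr0 hr1
  have hq0 : 0 < r * Real.exp (-(1 / 2)) := by positivity
  have hlogq : Real.log (r * Real.exp (-(1 / 2))) = Real.log r - 1 / 2 := by
    rw [Real.log_mul hr0.ne' (Real.exp_pos _).ne', Real.log_exp]
    ring
  rw [← Real.log_le_log_iff (by positivity) (by positivity), Real.log_mul hε.ne' (by positivity),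
    Real.log_pow, Real.log_pow, hlogq]
  have h1 : -Real.log r / (-Real.log r + 1 / 2) * (Real.log ε / Real.log r)
      = Real.log ε / (Real.log r - 1 / 2) := by
    have h2 : -Real.log r + 1 / 2 ≠ 0 := by linarith
    have h3 : Real.log r - 1 / 2 ≠ 0 := by linarith
    have h4 := hl.ne
    rw [div_mul_div_comm, div_eq_div_iff (mul_ne_zero h2 h4) h3]
    ring
  rw [h1] at hn
  have h2 : Real.log r - 1 / 2 < 0 := by linarith
  have h3 := mul_le_mul_of_nonpos_right hn h2.le
  rw [add_mul, div_mul_cancel₀ _ h2.ne] at h3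
  linarith

/-- The amplification of the sampling variance at order `n ≤ 2 log (1/ε) + D`. -/
theorem sum_weight_sq_le_rpow {B ε D : ℝ} (hB : 1 < B) (hε : 0 < ε) {n : ℕ}
    (hn : (n : ℝ) ≤ -2 * Real.log ε + D) :
    8 * ∑ j, weight B n j ^ 2
      ≤ 2 * (B - 1) ^ 2 * kappa B ^ (2 * D + 2) * ε ^ (-(4 * Real.log (kappa B))) := by
  have hκ := one_lt_kappa hB
  have hκ0 : 0 < kappa B := by linarith
  have h1 : kappa B ^ (2 * (n + 1))
      ≤ kappa B ^ (2 * D + 2) * ε ^ (-(4 * Real.log (kappa B))) := by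
    rw [Real.rpow_def_of_pos hε, Real.rpow_def_of_pos hκ0, ← Real.exp_add,
      ← Real.exp_log (pow_pos hκ0 _), Real.log_pow]
    apply Real.exp_le_exp.2
    push_cast
    nlinarith [Real.log_pos hκ, mul_le_mul_of_nonneg_right hn (Real.log_pos hκ).le]
  have h2 := mul_le_mul_of_nonneg_left h1 (by positivity : 0 ≤ 2 * (B - 1) ^ 2)
  linarith [sum_weight_sq_le hB n]

end JointMitigation

theorem theorem10 (B θ lam : ℝ) (hB : 1 < B) (hθ : 0 < θ) (hlam : B ≤ lam) (hlamθ : lam * θ < 1)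
    (hrate : JointMitigation.rate B θ lam < 1) :
    -- `c₁`, `c₂` and the function `K` depend on `B, θ, lam` only; `n₀` depends on `T` and `α` too
    ∃ (c₁ c₂ : ℝ) (K : ℝ → ℝ), 0 < c₁ ∧ c₁ < c₂ ∧ (∀ D, 0 < K D) ∧
      ∀ T α : ℝ, 0 ≤ T → ∃ n₀ : ℝ,
      ∀ (ι : Type*) [Fintype ι] [DecidableEq ι] (M : JointMitigation.Model ι) (c : ℝ)
        (ρ : ℝ → ℝ → ℝ → Matrix ι ι ℂ) (A : Matrix ι ι ℂ),
        0 < c →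
        (∀ j, JointMitigation.InducedNormLE (M.coeff c j) (θ ^ j)) →
        M.IsSolution c B T ρ →
        A.IsHermitian →
        JointMitigation.opNorm A ≤ α →
        ∀ (ε δ : ℝ), 0 < ε → ε < Real.exp (-Real.exp 1) → 0 < δ → δ < 1 →
        ∀ n : ℕ, c₁ * (Real.log ε / Real.log (JointMitigation.rate B θ lam)) + n₀ ≤ n →
          |JointMitigation.richardson B n (fun j => JointMitigation.expect A
              (JointMitigation.jointState c T ρ (JointMitigation.chebNode B n j)))
            - JointMitigation.expect A (JointMitigation.jointState c T ρ 0)| < ε ∧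
          ∀ D : ℝ, (n : ℝ) ≤ c₂ * (Real.log ε / Real.log (JointMitigation.rate B θ lam)) + D →
            ∀ N : ℕ,
              K D * (α ^ 2 * ε ^ (-(2 + 4 * Real.log (JointMitigation.kappa B)))
                * Real.log (2 / δ)) ≤ N →
              ∀ (Ω : Type*) [MeasurableSpace Ω] (P : MeasureTheory.Measure Ω)
                [MeasureTheory.IsProbabilityMeasure P] (X : Fin (n + 1) → Fin N → Ω → ℝ),
                JointMitigation.IsShotRecord P A
                  (fun j => JointMitigation.jointState c T ρ (JointMitigation.chebNode B n j)) X →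
                1 - δ ≤ P.real {ω |
                  |JointMitigation.richardson B n
                      (fun j => JointMitigation.sampleMean (fun i => X j i ω))
                    - JointMitigation.expect A (JointMitigation.jointState c T ρ 0)| < ε} := by
  have hr0 := JointMitigation.rate_pos hB hθ hlamθ
  have hκ := JointMitigation.one_lt_kappa hB
  have hκ0 : 0 < JointMitigation.kappa B := by linarith
  have hB1 : 0 < B - 1 := by linarith
  set r := JointMitigation.rate B θ lam with hr
  have hl : Real.log r < 0 := Real.log_neg hr0 hrate
  set s := Real.exp (-(1 / 2)) / JointMitigation.kappa B with hs
  have he1 : Real.exp (-(1 / 2)) < 1 := by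
    rw [← Real.exp_zero]
    exact Real.exp_lt_exp.2 (by norm_num)
  have hs0 : 0 < s := by positivity
  have hs1 : s < 1 := by
    rw [hs, div_lt_one hκ0]
    linarith
  have hq0 : 0 < r * Real.exp (-(1 / 2)) := by positivity
  have hq1 : r * Real.exp (-(1 / 2)) < 1 :=
    mul_lt_one_of_nonneg_of_lt_one_left hr0.le hrate he1.le
  -- `c₁` makes the bias of rate `e^(-1/2) r` reach `ε`; `c₂` makes `κ ^ (2 n)` stay below
  -- `κ ^ (2 D) ε ^ (-4 log κ)`
  refine ⟨-Real.log r / (-Real.log r + 1 / 2), -2 * Real.log r,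
    fun D => 2 * (B - 1) ^ 2 * JointMitigation.kappa B ^ (2 * D + 2),
    div_pos (by linarith) (by linarith), ?_, fun D => by positivity, ?_⟩
  · rw [div_lt_iff₀ (by linarith)]
    nlinarith
  intro T α hT
  set C := |α| * Real.exp (T / ((1 - lam * θ) * (1 - s))) with hC
  have hC0 : 0 ≤ C := by positivity
  -- after `k` extra nodes the prefactor `2 C` of the bias drops below `1 / 2`
  obtain ⟨k, hk⟩ := exists_pow_lt_of_lt_one (show 0 < 1 / (4 * (C + 1)) by positivity) hq1
  refine ⟨k, ?_⟩
  intro ι _ _ M c ρ A hc hM hρ _ hA ε δ hε _ hδ hδ1 n hn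
  have : Nonempty ι := M.nonempty
  have hα : 0 ≤ α := (JointMitigation.opNorm_nonneg A).trans hA
  have hbias : |JointMitigation.richardson B n (fun j => JointMitigation.expect A
        (JointMitigation.jointState c T ρ (JointMitigation.chebNode B n j)))
      - JointMitigation.expect A (JointMitigation.jointState c T ρ 0)| < ε / 2 := by
    have h1 := JointMitigation.abs_richardson_expect_sub_le hB hθ hlam hlamθ hs0 hs1 hc hT hM hρ
      hA n
    rw [hs, JointMitigation.bias_rate_eq hB hlamθ, ← hs, ← hr, ← abs_of_nonneg hα, ← hC] at h1
    refine h1.trans_lt ?_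
    have h2 := JointMitigation.pow_le_mul_pow_of_le hr0 hrate hε hn
    have h3 : (r * Real.exp (-(1 / 2))) ^ (n + 1) ≤ ε * (r * Real.exp (-(1 / 2))) ^ k :=
      (pow_le_pow_of_le_one hq0.le hq1.le n.le_succ).trans h2
    rw [lt_div_iff₀ (by positivity)] at hk
    calc 2 * C * (r * Real.exp (-(1 / 2))) ^ (n + 1)
        ≤ 2 * C * (ε * (r * Real.exp (-(1 / 2))) ^ k) := by gcongr
      _ = ε / 2 * ((r * Real.exp (-(1 / 2))) ^ k * (4 * C)) := by ring
      _ < ε / 2 * 1 := by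
        gcongr
        nlinarith [pow_pos hq0 k]
      _ = ε / 2 := mul_one _
  refine ⟨hbias.trans (half_lt_self hε), ?_⟩
  intro D hnD N hN Ω _ P _ X hX
  have hnD' : (n : ℝ) ≤ -2 * Real.log ε + D := by
    refine hnD.trans (le_of_eq ?_)
    rw [mul_assoc, mul_div_cancel₀ _ hl.ne]
  have hlog : 0 < Real.log (2 / δ) := Real.log_pos (by rw [lt_div_iff₀ hδ]; linarith)
  refine JointMitigation.one_sub_le_measureReal_richardson_lt hA hX hε hδ hbias ?_ ?_
  · rintro rfl
    by_contra hα0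
    have hαpos : 0 < α := lt_of_le_of_ne hα (Ne.symm hα0)
    rw [Nat.cast_zero] at hN
    refine absurd hN (not_le.2 ?_)
    positivity
  · have hΓ := JointMitigation.sum_weight_sq_le_rpow hB hε hnD'
    have hsplit : ε ^ (-(2 + 4 * Real.log (JointMitigation.kappa B))) * ε ^ 2
        = ε ^ (-(4 * Real.log (JointMitigation.kappa B))) := by
      rw [← Real.rpow_natCast ε 2, ← Real.rpow_add hε]
      congr 1
      push_cast
      ring
    calc 8 * α ^ 2 * (∑ j, JointMitigation.weight B n j ^ 2) * Real.log (2 / δ)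
        = (8 * ∑ j, JointMitigation.weight B n j ^ 2) * (α ^ 2 * Real.log (2 / δ)) := by ring
      _ ≤ (2 * (B - 1) ^ 2 * JointMitigation.kappa B ^ (2 * D + 2)
          * ε ^ (-(4 * Real.log (JointMitigation.kappa B)))) * (α ^ 2 * Real.log (2 / δ)) := by
        gcongr
      _ = (2 * (B - 1) ^ 2 * JointMitigation.kappa B ^ (2 * D + 2)
          * (α ^ 2 * ε ^ (-(2 + 4 * Real.log (JointMitigation.kappa B))) * Real.log (2 / δ)))
          * ε ^ 2 := by
        rw [← hsplit]
        ring
      _ ≤ N * ε ^ 2 := by gcongr
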